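/- Let $D=\{z\in\mathbb{C}: |\operatorname{Re} z-\tfrac12|+|\operatorname{Im} z|<\tfrac12\}$ be the open square with diagonals $(0,1)$ and $(\tfrac12-\tfrac i2,\tfrac12+\tfrac i2)$ (open segments), let $dA$ be planar Lebesgue measure, and let $A^2(D)$ be the space of holomorphic functions $f$ on $D$ with $\int_D|f|^2\,dA<\infty$. For a function $f$ that is $C^\infty$ on each of the two open diagonals put $$S(f)=\sum_{n=0}^{\infty}\frac{2^n}{(2n+1)!}\int_0^{1/2}x^{2n+1}\Big(|f^{(n)}(x)|^2+|f^{(n)}(1-x)|^2+\big|f^{(n)}\big(\tfrac12+i(\tfrac12-x)\big)\big|^2+\big|f^{(n)}\big(\tfrac12+i(x-\tfrac12)\big)\big|^2\Big)\,dx\in[0,\infty],$$ where $f^{(n)}$ is the $n$-th complex derivative if $f$ is holomorphic on $D$, and in general the $n$-th derivative along the diagonal, that is, $f^{(n)}(x)=\frac{d^n}{dx^n}f(x)$ on $(0,1)$ and $f^{(n)}(\tfrac12+it)=(-i)^n\frac{d^n}{dt^n}f(\tfrac12+it)$ on the other diagonal. Theorem. There are absolute constants $c,C>0$ such that the following hold.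 (1) For every $f\in A^2(D)$, $$c\int_D|f|^2\,dA\le S(f)\le C\int_D|f|^2\,dA.$$ (2) Let $f$ be a function on the union of the two open diagonals and a neighborhood of $\tfrac12$ which is $C^\infty$ on each of the two open diagonals and holomorphic in that neighborhood of $\tfrac12$. If $S(f)<\infty$, then there is $F\in A^2(D)$ that coincides with $f$ on both diagonals and near $\tfrac12$, and $$c\int_D|F|^2\,dA\le S(f)\le C\int_D|F|^2\,dA.$$ -/

import Mathlib

open MeasureTheory Set Filter Topology
open scoped ENNReal NNReal ContDiff

/-- The open square with diagonals `(0, 1)` and `(1/2 - i/2, 1/2 + i/2)`. -/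
def square : Set ℂ := {z | |z.re - 1 / 2| + |z.im| < 1 / 2}

/-- The horizontal diagonal, the open segment from `0` to `1`. -/
def horizontalDiagonal : Set ℂ := {z | z.re ∈ Ioo (0 : ℝ) 1 ∧ z.im = 0}

/-- The vertical diagonal, the open segment from `1/2 - i/2` to `1/2 + i/2`. -/
def verticalDiagonal : Set ℂ := {z | z.re = 1 / 2 ∧ z.im ∈ Ioo (-(1 / 2) : ℝ) (1 / 2)}

/-- The squared Bergman norm `∫_D |f|² dA` on the square (possibly infinite). -/
noncomputable def bergmanNormSq (f : ℂ → ℂ) : ℝ≥0∞ :=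
  ∫⁻ z in square, ‖f z‖ₑ ^ 2

/-- `f` belongs to the Bergman space `A²(D)` of the square: it is holomorphic and square
integrable there. -/
def MemBergman (f : ℂ → ℂ) : Prop :=
  DifferentiableOn ℂ f square ∧ bergmanNormSq f < ⊤

/-- The sum over `n` of `2^n / (2n+1)! ∫_0^{1/2} x^(2n+1) (…) dx`, where `d n z` stands for the
`n`-th derivative at the point `z`, and where the bracket adds `|d n z|²` over the four points
`x`, `1 - x`, `1/2 + i (1/2 - x)` and `1/2 + i (x - 1/2)` of the two diagonals. -/
noncomputable def diagonalSum (d : ℕ → ℂ → ℂ) : ℝ≥0∞ :=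
  ∑' n : ℕ, ENNReal.ofReal (2 ^ n / ((2 * n + 1).factorial : ℝ)) *
    ∫⁻ x : ℝ in Ioo (0 : ℝ) (1 / 2),
      ENNReal.ofReal (x ^ (2 * n + 1) *
        (‖d n (x : ℂ)‖ ^ 2 + ‖d n (1 - (x : ℂ))‖ ^ 2
          + ‖d n (1 / 2 + Complex.I * (1 / 2 - (x : ℂ)))‖ ^ 2
          + ‖d n (1 / 2 + Complex.I * ((x : ℂ) - 1 / 2))‖ ^ 2))

/-- The `n`-th derivative at `z` along the diagonals, for a function that need only be smooth on
the two diagonals. On the horizontal diagonal it is the `n`-th derivative of `t ↦ f t`. On the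
vertical one, `z = 1/2 + i t`, so `d/dz = -i d/dt`. -/
noncomputable def derivAlongDiagonals (f : ℂ → ℂ) (n : ℕ) (z : ℂ) : ℂ :=
  if z.im = 0 then iteratedDeriv n (fun t : ℝ => f (t : ℂ)) z.re
  else (-Complex.I) ^ n * iteratedDeriv n (fun t : ℝ => f (1 / 2 + Complex.I * (t : ℂ))) z.im

/-- `f` is of class `C^∞` on each of the two open diagonals (as a function of a real parameter). -/
def SmoothOnDiagonals (f : ℂ → ℂ) : Prop :=
  ContDiffOn ℝ ∞ (fun t : ℝ => f (t : ℂ)) (Ioo (0 : ℝ) 1) ∧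
  ContDiffOn ℝ ∞ (fun t : ℝ => f (1 / 2 + Complex.I * (t : ℂ))) (Ioo (-(1 / 2) : ℝ) (1 / 2))

/-! The sum turns into a weighted area integral. For `0 < x ≤ 1/2` the disc about `x` of radius `x /
√2` lies in the square. Parseval on circles, integrated against the radial weight `1 / (π √(x² -
2r²))`, turns `∫ |f|² k_x dA` into `∑ 2^n / (2n+1)! x^(2n+1) |f⁽ⁿ⁾(x)|²` (`lintegral_diskKernel`).
Integrating over `x ∈ (0, 1/2)` gives `∫ |f|² w dA` with `w(z) = ∫ k_x(z) dx`. As a function of `x`,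
`k_x(z)` is an arcsine density centred at `2 Re z`, so `w ≤ 1`, and a quarter of its mass falls in
`(0, 1/2)` when `z` is in the quarter of the square next to `0`. Summing over the four rotations
gives a total weight between `1/4` and `4`, which proves (1) for every holomorphic `f`.

For (2), finiteness of the sum bounds the `L²` norms of all derivatives on compact subintervals of
each half-diagonal, so Taylor remainders vanish locally. For almost every `x` the pointwise sum is
finite too, and the Taylor series at `x` converges in the whole disc of radius `x / √2`. Such
centres are dense, so the sums glue to a holomorphic function on the union of the discs. The four
unions cover the square and meet pairwise only inside the inscribed disc, where the given germ at
`1/2` forces agreement. Finally (1), applied to the extension, gives membership in `A²`. -/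

/-! ### Arcsine integrals and radial moments -/

/-- Substitution `t = m + s sin φ` in a lower Lebesgue integral. -/
lemma lintegral_sin_substitution {m s α β : ℝ} (hs : 0 < s) (hα : -(Real.pi / 2) ≤ α)
    (hβ : β ≤ Real.pi / 2) (g : ℝ → ℝ≥0∞) :
    ∫⁻ t in (fun φ => m + s * Real.sin φ) '' Ioo α β, g t =
      ∫⁻ φ in Ioo α β, ENNReal.ofReal (s * Real.cos φ) * g (m + s * Real.sin φ) := by
  have hinj : InjOn (fun φ => m + s * Real.sin φ) (Ioo α β) := by
    intro x hx y hy hxy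
    have : Real.sin x = Real.sin y := by
      have := mul_left_cancel₀ hs.ne' (add_left_cancel hxy)
      exact this
    exact Real.injOn_sin ⟨by linarith [hx.1], by linarith [hx.2]⟩
      ⟨by linarith [hy.1], by linarith [hy.2]⟩ this
  rw [lintegral_image_eq_lintegral_abs_deriv_mul (f' := fun φ => s * Real.cos φ)
    measurableSet_Ioo (fun x _ => (((Real.hasDerivAt_sin x).const_mul s).const_add m).hasDerivWithinAt)
    hinj]
  refine setLIntegral_congr_fun measurableSet_Ioo fun φ hφ => ?_
  have : 0 ≤ s * Real.cos φ := mul_nonneg hs.le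
    (Real.cos_nonneg_of_mem_Icc ⟨by linarith [hφ.1], by linarith [hφ.2]⟩)
  simp only [abs_of_nonneg this]

lemma image_sin_Ioo {m s α β : ℝ} (hs : 0 < s) (hα : -(Real.pi / 2) ≤ α)
    (hβ : β ≤ Real.pi / 2) (hαβ : α ≤ β) :
    (fun φ => m + s * Real.sin φ) '' Ioo α β = Ioo (m + s * Real.sin α) (m + s * Real.sin β) := by
  apply Subset.antisymm
  · rintro _ ⟨φ, hφ, rfl⟩
    have h1 := Real.sin_lt_sin_of_lt_of_le_pi_div_two hα (hφ.2.le.trans hβ) hφ.1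
    have h2 := Real.sin_lt_sin_of_lt_of_le_pi_div_two (hα.trans hφ.1.le) hβ hφ.2
    constructor <;> simp only <;> nlinarith
  · exact intermediate_value_Ioo (f := fun φ => m + s * Real.sin φ) hαβ
      (Continuous.continuousOn (by fun_prop))

/-- The Jacobian of `t = s sin φ` cancels the inverse square root, so the arcsine density becomes
uniform in `φ`. -/
lemma mul_inv_sqrt_sq_sub {s φ : ℝ} (hs : 0 < s) (hc : 0 < Real.cos φ) :
    s * Real.cos φ * (Real.sqrt (s ^ 2 - (s * Real.sin φ) ^ 2))⁻¹ = 1 := by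
  have : s ^ 2 - (s * Real.sin φ) ^ 2 = (s * Real.cos φ) ^ 2 := by
    have := Real.sin_sq_add_cos_sq φ
    linear_combination (-s ^ 2) * this
  rw [this, Real.sqrt_sq (by positivity)]
  field_simp

/-- The arcsine law on an arc. -/
lemma setLIntegral_arcsine {m s α β : ℝ} (hs : 0 < s) (hα : -(Real.pi / 2) ≤ α)
    (hβ : β ≤ Real.pi / 2) (hαβ : α ≤ β) :
    ∫⁻ t in Ioo (m + s * Real.sin α) (m + s * Real.sin β),
      ENNReal.ofReal ((Real.pi * Real.sqrt (s ^ 2 - (t - m) ^ 2))⁻¹) =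
      ENNReal.ofReal ((β - α) / Real.pi) := by
  rw [← image_sin_Ioo hs hα hβ hαβ, lintegral_sin_substitution hs hα hβ]
  have : ∀ φ ∈ Ioo α β, ENNReal.ofReal (s * Real.cos φ) *
      ENNReal.ofReal ((Real.pi * Real.sqrt (s ^ 2 - (m + s * Real.sin φ - m) ^ 2))⁻¹) =
      ENNReal.ofReal (Real.pi⁻¹) := by
    intro φ hφ
    have hc : 0 < Real.cos φ := Real.cos_pos_of_mem_Ioo ⟨by linarith [hφ.1], by linarith [hφ.2]⟩
    rw [← ENNReal.ofReal_mul (by positivity), add_sub_cancel_left, mul_inv]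
    congr 1
    linear_combination Real.pi⁻¹ * mul_inv_sqrt_sq_sub hs hc
  rw [setLIntegral_congr_fun measurableSet_Ioo this, setLIntegral_const, Real.volume_Ioo,
    ← ENNReal.ofReal_mul (by positivity)]
  congr 1
  ring

/-- The arcsine law. -/
lemma lintegral_arcsine_le (m q : ℝ) :
    ∫⁻ t, ENNReal.ofReal ((Real.pi * Real.sqrt (q - (t - m) ^ 2))⁻¹) ≤ 1 := by
  rcases le_or_gt q 0 with hq | hq
  -- The square root of a negative number is `0`, and so is its inverse: the density vanishes off
  -- its interval by convention.
  · have : ∀ t : ℝ, ENNReal.ofReal ((Real.pi * Real.sqrt (q - (t - m) ^ 2))⁻¹) = 0 := by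
      intro t
      rw [Real.sqrt_eq_zero_of_nonpos (by nlinarith [sq_nonneg (t - m)])]
      simp
    simp only [this, lintegral_zero, zero_le]
  · obtain ⟨s, hs, rfl⟩ : ∃ s : ℝ, 0 < s ∧ q = s ^ 2 :=
      ⟨Real.sqrt q, Real.sqrt_pos.2 hq, (Real.sq_sqrt hq.le).symm⟩
    have hpi := Real.pi_pos
    have h := setLIntegral_arcsine (m := m) hs (le_refl (-(Real.pi / 2))) (le_refl (Real.pi / 2))
      (by linarith)
    rw [show (Real.pi / 2 - -(Real.pi / 2)) / Real.pi = 1 by field_simp; ring,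
      ENNReal.ofReal_one] at h
    rw [← h, ← lintegral_indicator measurableSet_Ioo]
    refine lintegral_mono fun t => ?_
    by_cases ht : t ∈ Ioo (m + s * Real.sin (-(Real.pi / 2))) (m + s * Real.sin (Real.pi / 2))
    · rw [indicator_of_mem ht]
    · rw [indicator_of_notMem ht]
      simp only [Real.sin_neg, Real.sin_pi_div_two, mem_Ioo, not_and_or, not_lt] at ht
      rw [Real.sqrt_eq_zero_of_nonpos (by rcases ht with ht | ht <;> nlinarith)]
      simp

/-- The Wallis product from `integral_sin_pow_odd`, in the factorial form that produces the
coefficients `2^n / (2n+1)!`. -/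
lemma prod_sin_pow_odd_eq (n : ℕ) :
    ∏ i ∈ Finset.range n, (2 * (i : ℝ) + 2) / (2 * i + 3) =
      4 ^ n * (n.factorial : ℝ) ^ 2 / (2 * n + 1).factorial := by
  induction n with
  | zero => simp
  | succ n ih =>
    rw [Finset.prod_range_succ, ih, show 2 * (n + 1) + 1 = (2 * n + 1) + 1 + 1 by ring,
      Nat.factorial_succ (2 * n + 1 + 1), Nat.factorial_succ (2 * n + 1), Nat.factorial_succ n]
    have := Nat.factorial_ne_zero (2 * n + 1)
    push_cast
    field_simp
    ring

/-- The radial moments of the weight `(x² - 2r²)^(-1/2)` on `(0, x / √2)`. -/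
lemma lintegral_radial_moment {x : ℝ} (hx : 0 < x) (n : ℕ) :
    ∫⁻ r in Ioo 0 (x / Real.sqrt 2),
      ENNReal.ofReal (r ^ (2 * n + 1) * (Real.sqrt (x ^ 2 - 2 * r ^ 2))⁻¹) =
      ENNReal.ofReal (2 ^ n * (n.factorial : ℝ) ^ 2 / (2 * (2 * n + 1).factorial) *
        x ^ (2 * n + 1)) := by
  set s := x / Real.sqrt 2 with hs'
  have h2 : (Real.sqrt 2) ^ 2 = 2 := Real.sq_sqrt (by norm_num)
  have h2p : 0 < Real.sqrt 2 := by positivity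
  have hs : 0 < s := by positivity
  have hss : x ^ 2 = 2 * s ^ 2 := by rw [hs', div_pow, h2]; ring
  have hpi := Real.pi_pos
  have him := image_sin_Ioo (m := 0) hs (α := 0) (by linarith) (le_refl (Real.pi / 2))
    (by linarith)
  simp only [Real.sin_zero, Real.sin_pi_div_two, mul_zero, mul_one, add_zero, zero_add] at him
  rw [← him]
  have hsub := lintegral_sin_substitution (m := 0) hs (α := 0) (by linarith) (le_refl (Real.pi / 2))
    (fun r => ENNReal.ofReal (r ^ (2 * n + 1) * (Real.sqrt (x ^ 2 - 2 * r ^ 2))⁻¹))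
  simp only [zero_add] at hsub
  rw [hsub]
  have key : ∀ φ ∈ Ioo 0 (Real.pi / 2), ENNReal.ofReal (s * Real.cos φ) *
      ENNReal.ofReal ((s * Real.sin φ) ^ (2 * n + 1) *
        (Real.sqrt (x ^ 2 - 2 * (s * Real.sin φ) ^ 2))⁻¹) =
      ENNReal.ofReal (s ^ (2 * n + 1) / Real.sqrt 2 * Real.sin φ ^ (2 * n + 1)) := by
    intro φ hφ
    have hc : 0 < Real.cos φ := Real.cos_pos_of_mem_Ioo ⟨by linarith [hφ.1], hφ.2⟩
    rw [← ENNReal.ofReal_mul (by positivity), hss, ← mul_sub, Real.sqrt_mul (by norm_num), mul_inv]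
    congr 1
    have := mul_inv_sqrt_sq_sub hs hc
    rw [mul_pow]
    linear_combination (s ^ (2 * n + 1) * Real.sin φ ^ (2 * n + 1) * (Real.sqrt 2)⁻¹) * this
  rw [setLIntegral_congr_fun measurableSet_Ioo key, ← ofReal_integral_eq_lintegral_ofReal]
  · rw [integral_const_mul, ← integral_Ioc_eq_integral_Ioo,
      ← intervalIntegral.integral_of_le (by linarith)]
    -- The known integral runs over `(0, π)`; the symmetry about `π/2` halves it.
    have hfull := integral_sin_pow_odd n
    rw [← intervalIntegral.integral_add_adjacent_intervals (b := Real.pi / 2)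
      ((Continuous.intervalIntegrable (by fun_prop) _ _))
      ((Continuous.intervalIntegrable (by fun_prop) _ _))] at hfull
    have hsym : ∫ φ in (Real.pi / 2)..Real.pi, Real.sin φ ^ (2 * n + 1) =
        ∫ φ in (0 : ℝ)..(Real.pi / 2), Real.sin φ ^ (2 * n + 1) := by
      have := intervalIntegral.integral_comp_sub_left (a := 0) (b := Real.pi / 2)
        (fun φ => Real.sin φ ^ (2 * n + 1)) Real.pi
      simp only [Real.sin_pi_sub, sub_zero] at this
      rw [this]
      congr 1
      ring
    rw [hsym, prod_sin_pow_odd_eq] at hfull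
    have hval : ∫ φ in (0 : ℝ)..(Real.pi / 2), Real.sin φ ^ (2 * n + 1) =
      4 ^ n * (n.factorial : ℝ) ^ 2 / (2 * n + 1).factorial := by linarith
    rw [hval]
    congr 1
    have hxs : x ^ (2 * n + 1) = 2 ^ n * Real.sqrt 2 * s ^ (2 * n + 1) := by
      have : x = s * Real.sqrt 2 := by rw [hs']; field_simp
      rw [this, mul_pow, pow_succ (Real.sqrt 2), pow_mul (Real.sqrt 2), h2]
      ring
    rw [hxs, show (4 : ℝ) ^ n = 2 ^ n * 2 ^ n by rw [← mul_pow]; norm_num]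
    have hfac : ((2 * n + 1).factorial : ℝ) ≠ 0 := by positivity
    field_simp
    rw [h2]
  · exact (Continuous.integrableOn_Icc (by fun_prop)).mono_set Ioo_subset_Icc_self
  · filter_upwards [self_mem_ae_restrict measurableSet_Ioo] with φ hφ
    have : 0 < Real.sin φ := Real.sin_pos_of_pos_of_lt_pi hφ.1 (by linarith [hφ.2])
    simp only [Pi.zero_apply]
    positivity

/-! ### Parseval's identity on circles -/

lemma integral_exp_int_mul (k : ℤ) :
    ∫ θ in (-Real.pi)..Real.pi, Complex.exp (k * θ * Complex.I) =
      if k = 0 then 2 * (Real.pi : ℂ) else 0 := by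
  split_ifs with hk
  · subst hk
    simp
    ring
  · have hk' : (k : ℂ) * Complex.I ≠ 0 := mul_ne_zero (by exact_mod_cast hk) Complex.I_ne_zero
    have := integral_exp_mul_complex (a := -Real.pi) (b := Real.pi) hk'
    rw [intervalIntegral.integral_congr (g := fun θ : ℝ => Complex.exp (k * Complex.I * θ))
      (fun θ _ => by simp only; ring_nf), this]
    have : Complex.exp (k * Complex.I * (Real.pi : ℝ)) =
        Complex.exp (k * Complex.I * ((-Real.pi : ℝ) : ℂ)) := by
      rw [Complex.exp_eq_exp_iff_exists_int]
      exact ⟨k, by push_cast; ring⟩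
    rw [this, sub_self, zero_div]

/-- Termwise integration of an absolutely convergent power series on a circle. -/
lemma hasSum_integral_tsum_exp_mul {c : ℕ → ℂ} (hc : Summable fun n => ‖c n‖) {h : ℝ → ℂ}
    (hh : Continuous h) {M : ℝ} (hM : ∀ θ, ‖h θ‖ ≤ M) :
    HasSum (fun n : ℕ => c n * ∫ θ in (-Real.pi)..Real.pi, Complex.exp (n * θ * Complex.I) * h θ)
      (∫ θ in (-Real.pi)..Real.pi, (∑' n : ℕ, c n * Complex.exp (n * θ * Complex.I)) * h θ) := by
  have hnorm : ∀ (n : ℕ) (θ : ℝ), ‖Complex.exp (n * θ * Complex.I)‖ = 1 := fun n θ => by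
    exact_mod_cast Complex.norm_exp_ofReal_mul_I (n * θ)
  simp_rw [← intervalIntegral.integral_const_mul]
  refine intervalIntegral.hasSum_integral_of_dominated_convergence (fun n _ => ‖c n‖ * M)
    (fun n => (Continuous.aestronglyMeasurable (by fun_prop))) (fun n => ?_) ?_ ?_ ?_
  · refine Eventually.of_forall fun θ _ => ?_
    rw [norm_mul, norm_mul, hnorm, one_mul]
    exact mul_le_mul_of_nonneg_left (hM θ) (norm_nonneg _)
  · exact Eventually.of_forall fun θ _ => hc.mul_right M
  · exact intervalIntegrable_const
  · refine Eventually.of_forall fun θ _ => ?_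
    have : Summable fun n : ℕ => c n * Complex.exp (n * θ * Complex.I) :=
      Summable.of_norm (by simpa only [norm_mul, hnorm, mul_one] using hc)
    simpa only [mul_assoc] using this.hasSum.mul_right (h θ)

/-- The coefficients of an absolutely convergent power series on a circle. -/
lemma integral_tsum_exp_mul_exp_neg {c : ℕ → ℂ} (hc : Summable fun n => ‖c n‖) (m : ℕ) :
    ∫ θ in (-Real.pi)..Real.pi, (∑' n : ℕ, c n * Complex.exp (n * θ * Complex.I)) *
      Complex.exp (-(m * θ * Complex.I)) = 2 * Real.pi * c m := by
  have h1 := hasSum_integral_tsum_exp_mul hc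
    (h := fun θ : ℝ => Complex.exp (-(m * θ * Complex.I))) (by fun_prop) (M := 1)
    (fun θ => by
      have : ‖Complex.exp (m * θ * Complex.I)‖ = 1 := by
        exact_mod_cast Complex.norm_exp_ofReal_mul_I (m * θ)
      rw [Complex.exp_neg, norm_inv, this, inv_one])
  have h2 : ∀ n : ℕ, c n * ∫ θ in (-Real.pi)..Real.pi, Complex.exp (n * θ * Complex.I) *
      Complex.exp (-(m * θ * Complex.I)) = if n = m then c m * (2 * (Real.pi : ℂ)) else 0 := by
    intro n
    have h3 := integral_exp_int_mul ((n : ℤ) - m)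
    have h4 : ∫ θ in (-Real.pi)..Real.pi, Complex.exp (n * θ * Complex.I) *
        Complex.exp (-(m * θ * Complex.I)) =
        ∫ θ in (-Real.pi)..Real.pi, Complex.exp ((((n : ℤ) - m : ℤ) : ℂ) * θ * Complex.I) := by
      refine intervalIntegral.integral_congr fun θ _ => ?_
      simp only [← Complex.exp_add]
      congr 1
      push_cast
      ring
    rw [h4, h3]
    by_cases hnm : n = m
    · subst hnm
      simp
    · have : (n : ℤ) - m ≠ 0 := by omega
      simp [hnm, this]
  rw [funext h2] at h1
  rw [h1.unique (hasSum_ite_eq m (c m * (2 * Real.pi)))]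
  ring

/-- Parseval's identity for an absolutely convergent power series on a circle. -/
lemma lintegral_sq_enorm_tsum {c : ℕ → ℂ} (hc : Summable fun n => ‖c n‖) :
    ∫⁻ θ in Ioo (-Real.pi) Real.pi, ‖∑' n : ℕ, c n * Complex.exp (n * θ * Complex.I)‖ₑ ^ 2 =
      ENNReal.ofReal (2 * Real.pi) * ∑' n : ℕ, ENNReal.ofReal (‖c n‖ ^ 2) := by
  set g : ℝ → ℂ := fun θ => ∑' n : ℕ, c n * Complex.exp (n * θ * Complex.I) with hg
  have hpi := Real.pi_pos
  have hnorm : ∀ (n : ℕ) (θ : ℝ), ‖Complex.exp (n * θ * Complex.I)‖ = 1 := fun n θ => by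
    exact_mod_cast Complex.norm_exp_ofReal_mul_I (n * θ)
  have hgc : Continuous g := continuous_tsum (fun n => by fun_prop) hc
    (fun n θ => by rw [norm_mul, hnorm, mul_one])
  have hgM : ∀ θ, ‖g θ‖ ≤ ∑' n, ‖c n‖ := fun θ =>
    tsum_of_norm_bounded hc.hasSum fun n => by rw [norm_mul, hnorm, mul_one]
  have hcoef : ∀ m : ℕ, ∫ θ in (-Real.pi)..Real.pi, g θ * Complex.exp (-(m * θ * Complex.I)) =
      2 * Real.pi * c m := integral_tsum_exp_mul_exp_neg hc
  -- Only the first factor of `g * conj g` is expanded; each resulting integral is the conjugate of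
  -- a coefficient integral `hcoef`.
  have hconj := hasSum_integral_tsum_exp_mul hc (h := fun θ => (starRingEnd ℂ) (g θ))
    (Complex.continuous_conj.comp hgc) (fun θ => by rw [RCLike.norm_conj]; exact hgM θ)
  have hc2 : ∀ n : ℕ, c n * ∫ θ in (-Real.pi)..Real.pi, Complex.exp (n * θ * Complex.I) *
      (starRingEnd ℂ) (g θ) = ((2 * Real.pi * ‖c n‖ ^ 2 : ℝ) : ℂ) := by
    intro n
    have : ∫ θ in (-Real.pi)..Real.pi, Complex.exp (n * θ * Complex.I) *
      (starRingEnd ℂ) (g θ) = (starRingEnd ℂ) (2 * Real.pi * c n) := by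
      rw [← hcoef n, intervalIntegral.integral_of_le (by linarith),
        intervalIntegral.integral_of_le (by linarith), ← integral_conj]
      refine integral_congr_ae (Eventually.of_forall fun θ => ?_)
      simp only [map_mul, ← Complex.exp_conj, map_neg, Complex.conj_ofReal, Complex.conj_I,
        map_natCast]
      rw [mul_comm]
      congr 2
      ring
    rw [this]
    simp only [map_mul, Complex.conj_ofReal, map_ofNat]
    push_cast
    rw [← Complex.mul_conj']
    ring
  have hre : ∫ θ in (-Real.pi)..Real.pi, g θ * (starRingEnd ℂ) (g θ) =
      ((∫ θ in (-Real.pi)..Real.pi, ‖g θ‖ ^ 2 : ℝ) : ℂ) := by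
    rw [← intervalIntegral.integral_ofReal]
    refine intervalIntegral.integral_congr fun θ _ => ?_
    simp only [Complex.mul_conj', Complex.ofReal_pow]
  simp only [hc2] at hconj
  rw [hre] at hconj
  have hsum := Complex.hasSum_ofReal.1 hconj
  calc ∫⁻ θ in Ioo (-Real.pi) Real.pi, ‖g θ‖ₑ ^ 2
      = ∫⁻ θ in Ioo (-Real.pi) Real.pi, ENNReal.ofReal (‖g θ‖ ^ 2) := by
        simp only [ENNReal.ofReal_pow (norm_nonneg _), ofReal_norm]
    _ = ENNReal.ofReal (∫ θ in (-Real.pi)..Real.pi, ‖g θ‖ ^ 2) := by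
        rw [← ofReal_integral_eq_lintegral_ofReal, intervalIntegral.integral_of_le (by linarith),
          integral_Ioc_eq_integral_Ioo]
        · exact (Continuous.integrableOn_Icc (by fun_prop)).mono_set Ioo_subset_Icc_self
        · exact Eventually.of_forall fun θ => by positivity
    _ = _ := by
        rw [← hsum.tsum_eq, ENNReal.ofReal_tsum_of_nonneg (fun n => by positivity) hsum.summable,
          ← ENNReal.tsum_mul_left]
        exact tsum_congr fun n => ENNReal.ofReal_mul (by positivity)

/-! ### The kernel of a disc and the local identity -/

/-- The kernel `1 / (π √(x² - 2|z - x|²))` on the disc of radius `x / √2` about `x`,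
extended by zero. -/
noncomputable def diskKernel (x : ℝ) (z : ℂ) : ℝ≥0∞ :=
  ENNReal.ofReal ((Real.pi * Real.sqrt (x ^ 2 - 2 * ‖z - x‖ ^ 2))⁻¹)

lemma measurable_diskKernel : Measurable (Function.uncurry diskKernel) := by
  unfold diskKernel Function.uncurry
  fun_prop

/-- Completing the square in `x` instead of `z` exhibits the arcsine density in `x`, centred at `2
Re z`. -/
lemma diskKernel_eq (x : ℝ) (z : ℂ) : diskKernel x z = ENNReal.ofReal
    ((Real.pi * Real.sqrt (2 * (z.re ^ 2 - z.im ^ 2) - (x - 2 * z.re) ^ 2))⁻¹) := by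
  unfold diskKernel
  congr 4
  rw [← Complex.normSq_eq_norm_sq, Complex.normSq_apply]
  simp only [Complex.sub_re, Complex.sub_im, Complex.ofReal_re, Complex.ofReal_im]
  ring

/-- Parseval applied to the Taylor series at `x`, whose coefficients on the circle are `f⁽ⁿ⁾(x) r^n
/ n!`. -/
lemma circle_lintegral_eq {f : ℂ → ℂ} {x R r : ℝ} (hf : DifferentiableOn ℂ f (Metric.ball (x : ℂ) R))
    (hr : 0 < r) (hrR : r < R) :
    ∫⁻ θ in Ioo (-Real.pi) Real.pi, ‖f (x + Complex.polarCoord.symm (r, θ))‖ₑ ^ 2 =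
      ENNReal.ofReal (2 * Real.pi) * ∑' n : ℕ,
        ENNReal.ofReal (‖iteratedDeriv n f x‖ ^ 2 / (n.factorial : ℝ) ^ 2 * r ^ (2 * n)) := by
  set c : ℕ → ℂ := fun n => (n.factorial : ℂ)⁻¹ * r ^ n * iteratedDeriv n f x with hc'
  have hsum : ∀ θ : ℝ, HasSum (fun n : ℕ => c n * Complex.exp (n * θ * Complex.I))
      (f (x + Complex.polarCoord.symm (r, θ))) := by
    intro θ
    have he : Complex.polarCoord.symm (r, θ) = r * Complex.exp (θ * Complex.I) := by
      rw [Complex.polarCoord_symm_apply, Complex.exp_mul_I]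
      simp
    have hmem : (x : ℂ) + Complex.polarCoord.symm (r, θ) ∈ Metric.ball (x : ℂ) R := by
      rw [mem_ball_iff_norm, add_sub_cancel_left, he, norm_mul, Complex.norm_exp_ofReal_mul_I,
        mul_one, Complex.norm_real, Real.norm_of_nonneg hr.le]
      exact hrR
    have := Complex.hasSum_taylorSeries_on_ball hf hmem
    rw [add_sub_cancel_left] at this
    have heq : (fun n : ℕ => c n * Complex.exp (n * θ * Complex.I)) = fun n : ℕ =>
        (n.factorial : ℂ)⁻¹ • Complex.polarCoord.symm (r, θ) ^ n • iteratedDeriv n f x := by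
      funext n
      rw [he, mul_pow, ← Complex.exp_nat_mul, hc']
      simp only [smul_eq_mul]
      ring_nf
    rwa [heq]
  have hcs : Summable fun n => ‖c n‖ := by
    have := (hsum 0).summable.norm
    simpa using this
  simp_rw [← (hsum _).tsum_eq]
  rw [lintegral_sq_enorm_tsum hcs]
  congr 1
  refine tsum_congr fun n => ?_
  congr 1
  rw [hc']
  simp only [norm_mul, norm_inv, norm_pow, Complex.norm_natCast, Complex.norm_real,
    Real.norm_of_nonneg hr.le]
  rw [mul_pow, mul_pow, ← pow_mul, mul_comm n 2]
  field_simp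

/-- The local identity behind the Aikawa–Hayashi–Saitoh formula. -/
lemma lintegral_diskKernel {f : ℂ → ℂ} {x : ℝ} (hx : 0 < x) (hfm : Measurable f)
    (hf : DifferentiableOn ℂ f (Metric.ball (x : ℂ) (x / Real.sqrt 2))) :
    ∫⁻ z, ‖f z‖ₑ ^ 2 * diskKernel x z =
      ∑' n : ℕ, ENNReal.ofReal (2 ^ n / ((2 * n + 1).factorial : ℝ)) *
        ENNReal.ofReal (x ^ (2 * n + 1) * ‖iteratedDeriv n f x‖ ^ 2) := by
  have hpi := Real.pi_pos
  have hkm : Measurable (diskKernel x) := measurable_diskKernel.comp measurable_prodMk_left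
  set R := x / Real.sqrt 2 with hR
  have hRp : 0 < R := by positivity
  have hRR : x ^ 2 = 2 * R ^ 2 := by
    rw [hR, div_pow, Real.sq_sqrt (by norm_num)]
    ring
  have hpolar : ∀ r θ : ℝ, 0 < r → diskKernel x (x + Complex.polarCoord.symm (r, θ)) =
      ENNReal.ofReal ((Real.pi * Real.sqrt (x ^ 2 - 2 * r ^ 2))⁻¹) := by
    intro r θ hr
    rw [diskKernel, add_sub_cancel_left, Complex.norm_polarCoord_symm, abs_of_pos hr]
  have hsm : Measurable fun p : ℝ × ℝ => Complex.polarCoord.symm p := by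
    simp only [Complex.polarCoord_symm_apply]
    fun_prop
  rw [← lintegral_add_left_eq_self _ (x : ℂ), ← Complex.lintegral_comp_polarCoord_symm,
    show polarCoord.target = Ioi (0 : ℝ) ×ˢ Ioo (-Real.pi) Real.pi from rfl, Measure.volume_eq_prod, setLIntegral_prod]
  swap
  · refine Measurable.aemeasurable ?_
    have h1 : Measurable fun p : ℝ × ℝ => (x : ℂ) + Complex.polarCoord.symm p :=
      hsm.const_add _
    exact (ENNReal.measurable_ofReal.comp measurable_fst).mul
      (((hfm.comp h1).enorm.pow_const 2).mul (hkm.comp h1))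
  have hinner : ∀ r ∈ Ioi (0 : ℝ), ∫⁻ θ in Ioo (-Real.pi) Real.pi, ENNReal.ofReal (r, θ).1 •
      (‖f (x + Complex.polarCoord.symm (r, θ))‖ₑ ^ 2 *
        diskKernel x (x + Complex.polarCoord.symm (r, θ))) =
      (Ioo 0 R).indicator (fun r => ∑' n : ℕ,
        ENNReal.ofReal (2 * (‖iteratedDeriv n f x‖ ^ 2 / (n.factorial : ℝ) ^ 2)) *
        ENNReal.ofReal (r ^ (2 * n + 1) * (Real.sqrt (x ^ 2 - 2 * r ^ 2))⁻¹)) r := by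
    intro r hr
    have hr : 0 < r := hr
    simp only [hpolar r _ hr, smul_eq_mul]
    -- Beyond radius `R` the kernel is zero, so the values of `f` outside the disc do not matter.
    by_cases hrR : r < R
    · rw [indicator_of_mem (show r ∈ Ioo 0 R from ⟨hr, hrR⟩), lintegral_const_mul' _ _ ENNReal.ofReal_ne_top,
        lintegral_mul_const' _ _ ENNReal.ofReal_ne_top, circle_lintegral_eq hf hr hrR, mul_assoc, mul_comm,
        mul_assoc, mul_assoc, ← ENNReal.tsum_mul_right, ← ENNReal.tsum_mul_left]
      refine tsum_congr fun n => ?_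
      rw [← ENNReal.ofReal_mul (by positivity), ← ENNReal.ofReal_mul (by positivity),
        ← ENNReal.ofReal_mul (by positivity), ← ENNReal.ofReal_mul (by positivity)]
      congr 1
      rw [mul_inv]
      field_simp
      ring
    · rw [indicator_of_notMem (fun h => hrR h.2), Real.sqrt_eq_zero_of_nonpos]
      · simp
      · rw [hRR]
        nlinarith [not_lt.1 hrR]
  rw [setLIntegral_congr_fun measurableSet_Ioi hinner, lintegral_indicator measurableSet_Ioo,
    Measure.restrict_restrict measurableSet_Ioo,
    inter_eq_left.2 (Ioo_subset_Ioi_self), lintegral_tsum]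
  · refine tsum_congr fun n => ?_
    rw [lintegral_const_mul' _ _ ENNReal.ofReal_ne_top, lintegral_radial_moment hx,
      ← ENNReal.ofReal_mul (by positivity), ← ENNReal.ofReal_mul (by positivity)]
    congr 1
    field_simp
  · intro n
    exact Measurable.aemeasurable (by fun_prop)

/-! ### The weight of one arm and its bounds -/

/-- The contribution of the half of a diagonal that ends at the vertex `0`. -/
noncomputable def armSum (e : ℕ → ℝ → ℂ) : ℝ≥0∞ :=
  ∑' n : ℕ, ENNReal.ofReal (2 ^ n / ((2 * n + 1).factorial : ℝ)) *
    ∫⁻ x : ℝ in Ioo (0 : ℝ) (1 / 2), ENNReal.ofReal (x ^ (2 * n + 1) * ‖e n x‖ ^ 2)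

/-- The total mass at `z` of the kernels of the discs about the points of `(0, 1/2)`. -/
noncomputable def armWeight (z : ℂ) : ℝ≥0∞ := ∫⁻ x in Ioo (0 : ℝ) (1 / 2), diskKernel x z

lemma armWeight_le_one (z : ℂ) : armWeight z ≤ 1 := by
  refine (setLIntegral_le_lintegral _ _).trans ?_
  simp only [diskKernel_eq]
  exact lintegral_arcsine_le _ _

lemma isOpen_square : IsOpen square :=
  isOpen_lt (by fun_prop) continuous_const

/-- By `(a + b)² ≤ 2 (a² + b²)` the disc lies in the square `|Re z - x| + |Im z| < x`, which is
contained in `square` for `x ≤ 1/2`. -/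
lemma ball_subset_square {x : ℝ} (hx : x ∈ Ioc (0 : ℝ) (1 / 2)) :
    Metric.ball (x : ℂ) (x / Real.sqrt 2) ⊆ square := by
  intro z hz
  rw [mem_ball_iff_norm] at hz
  have h0 := hx.1
  have h1 : 2 * ‖z - x‖ ^ 2 < x ^ 2 := by
    have : x ^ 2 = 2 * (x / Real.sqrt 2) ^ 2 := by
      rw [div_pow, Real.sq_sqrt (by norm_num)]
      ring
    rw [this]
    have := norm_nonneg (z - x)
    gcongr
  rw [← Complex.normSq_eq_norm_sq, Complex.normSq_apply] at h1
  simp only [Complex.sub_re, Complex.sub_im, Complex.ofReal_re, Complex.ofReal_im, sub_zero] at h1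
  have h2 : |z.re - x| + |z.im| < x := by
    refine lt_of_pow_lt_pow_left₀ 2 h0.le ?_
    nlinarith [sq_nonneg (|z.re - x| - |z.im|), sq_abs (z.re - x), sq_abs z.im]
  have h3 : |z.re - 1 / 2| ≤ |z.re - x| + (1 / 2 - x) := by
    have := abs_sub_le z.re x (1 / 2)
    rwa [abs_of_nonpos (show x - 1 / 2 ≤ 0 by linarith [hx.2]), neg_sub] at this
  simp only [square, mem_ofPred_eq]
  linarith

lemma diskKernel_eq_zero_of_notMem_square {x : ℝ} (hx : x ∈ Ioc (0 : ℝ) (1 / 2)) {z : ℂ}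
    (hz : z ∉ square) : diskKernel x z = 0 := by
  have hz' : z ∉ Metric.ball (x : ℂ) (x / Real.sqrt 2) := fun h => hz (ball_subset_square hx h)
  rw [mem_ball_iff_norm, not_lt] at hz'
  have h0 := hx.1
  have : x ^ 2 = 2 * (x / Real.sqrt 2) ^ 2 := by
    rw [div_pow, Real.sq_sqrt (by norm_num)]
    ring
  rw [diskKernel, Real.sqrt_eq_zero_of_nonpos]
  · simp
  · rw [this]
    have : (x / Real.sqrt 2) ^ 2 ≤ ‖z - x‖ ^ 2 := by gcongr
    linarith

/-- The quarter of the square adjacent to the vertex `0`. -/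
def leftQuarter : Set ℂ := square ∩ {z | |z.im| ≤ 1 / 2 - z.re}

/-- With `a = Re z`, `b = Im z` and `s² = 2 (a² - b²)`, the angles from `-π/2` to `-π/4` carry a
quarter of the arcsine mass and correspond to `x` between `2a - s` and `2a - s/√2`. This interval
lies in `(0, 1/2)`. For `a > 1/4` its right end is controlled by `(4a - 1)(a - 1/2) ≤ 0`. -/
lemma quarter_le_armWeight {z : ℂ} (hz : z ∈ leftQuarter) : (1 / 4 : ℝ≥0∞) ≤ armWeight z := by
  obtain ⟨h1, h2⟩ := hz
  simp only [square, mem_ofPred_eq] at h1 h2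
  have hpi := Real.pi_pos
  have ha : z.re ≤ 1 / 2 := by linarith [abs_nonneg z.im]
  rw [abs_of_nonpos (by linarith)] at h1
  have hab : |z.im| < z.re := by linarith
  have hb0 := abs_nonneg z.im
  have hq : 0 < 2 * (z.re ^ 2 - z.im ^ 2) := by
    rw [← sq_abs z.im]
    nlinarith
  set s := Real.sqrt (2 * (z.re ^ 2 - z.im ^ 2)) with hs'
  have hs : 0 < s := Real.sqrt_pos.2 hq
  have hs2 : s ^ 2 = 2 * (z.re ^ 2 - z.im ^ 2) := Real.sq_sqrt hq.le
  have hr2 : Real.sqrt 2 ^ 2 = 2 := Real.sq_sqrt (by norm_num)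
  have hr2p : 0 < Real.sqrt 2 := by positivity
  have h := setLIntegral_arcsine (m := 2 * z.re) hs (le_refl (-(Real.pi / 2)))
    (show -(Real.pi / 4) ≤ Real.pi / 2 by linarith) (by linarith)
  rw [show (-(Real.pi / 4) - -(Real.pi / 2)) / Real.pi = 1 / 4 by field_simp; ring, Real.sin_neg,
    Real.sin_neg, Real.sin_pi_div_two, Real.sin_pi_div_four] at h
  have hsub : Ioo (2 * z.re + s * -1) (2 * z.re + s * -(Real.sqrt 2 / 2)) ⊆ Ioo 0 (1 / 2) := by
    refine Ioo_subset_Ioo ?_ ?_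
    · have : s ≤ 2 * z.re := by
        refine le_of_sq_le_sq ?_ (by linarith)
        nlinarith [sq_nonneg z.im]
      linarith
    · suffices 2 * z.re - 1 / 2 ≤ s * (Real.sqrt 2 / 2) by linarith
      rcases le_or_gt z.re (1 / 4) with h4 | h4
      · have : 0 < s * (Real.sqrt 2 / 2) := by positivity
        linarith
      · refine le_of_sq_le_sq ?_ (by positivity)
        rw [mul_pow, div_pow, hr2, hs2, ← sq_abs z.im]
        nlinarith
  have h4 : (1 / 4 : ℝ≥0∞) = ENNReal.ofReal (1 / 4) := by
    rw [ENNReal.ofReal_div_of_pos (by norm_num)]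
    simp
  rw [h4, ← h, armWeight]
  simp only [diskKernel_eq, hs2]
  exact lintegral_mono_set hsub

lemma measurable_armWeight : Measurable armWeight :=
  measurable_diskKernel.lintegral_prod_left'

lemma measurable_indicator_of_continuousOn {α β : Type*} [TopologicalSpace α] [MeasurableSpace α]
    [OpensMeasurableSpace α] [TopologicalSpace β] [MeasurableSpace β] [BorelSpace β] [Zero β]
    {f : α → β} {s : Set α} (hs : MeasurableSet s) (hf : ContinuousOn f s) :
    Measurable (s.indicator f) := by
  classical
  rw [← piecewise_eq_indicator]
  exact hf.measurable_piecewise continuousOn_const hs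

lemma continuousOn_iteratedDeriv_ofReal {f : ℂ → ℂ} (hf : DifferentiableOn ℂ f square) (n : ℕ) :
    ContinuousOn (fun x : ℝ => iteratedDeriv n f x) (Ioo (0 : ℝ) (1 / 2)) := by
  intro x hx
  have hx' : (x : ℂ) ∈ square := ball_subset_square ⟨hx.1, hx.2.le⟩
    (Metric.mem_ball_self (div_pos hx.1 (by positivity)))
  have h : AnalyticAt ℂ f x := hf.analyticAt (isOpen_square.mem_nhds hx')
  have : ContinuousAt (iteratedDeriv n f) (x : ℂ) := by
    rw [iteratedDeriv_eq_iterate]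
    exact (h.iterated_deriv n).continuousAt
  exact (ContinuousAt.comp (f := fun x : ℝ => (x : ℂ)) this
    Complex.continuous_ofReal.continuousAt).continuousWithinAt

lemma armSum_eq_lintegral_tsum {e : ℕ → ℝ → ℂ}
    (he : ∀ n, ContinuousOn (e n) (Ioo (0 : ℝ) (1 / 2))) :
    armSum e = ∫⁻ x in Ioo (0 : ℝ) (1 / 2), ∑' n : ℕ,
      ENNReal.ofReal (2 ^ n / ((2 * n + 1).factorial : ℝ)) *
        ENNReal.ofReal (x ^ (2 * n + 1) * ‖e n x‖ ^ 2) := by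
  rw [lintegral_tsum]
  · exact tsum_congr fun n => (lintegral_const_mul' _ _ (by simp)).symm
  · intro n
    have := he n
    exact (AEMeasurable.ennreal_ofReal
      (ContinuousOn.aemeasurable (by fun_prop) measurableSet_Ioo)).const_mul _

/-- The Aikawa–Hayashi–Saitoh formula, localised to the square. -/
lemma armSum_eq_lintegral {f : ℂ → ℂ} (hf : DifferentiableOn ℂ f square) :
    armSum (fun n x => iteratedDeriv n f x) = ∫⁻ z in square, ‖f z‖ₑ ^ 2 * armWeight z := by
  have hms := isOpen_square.measurableSet
  -- `f` is arbitrary off the square; the zero extension is measurable on the plane and has the same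
  -- derivatives inside.
  have hgm : Measurable (square.indicator f) :=
    measurable_indicator_of_continuousOn hms hf.continuousOn
  have hfg : EqOn (square.indicator f) f square := eqOn_indicator
  rw [armSum_eq_lintegral_tsum (continuousOn_iteratedDeriv_ofReal hf)]
  have h1 : ∀ x ∈ Ioo (0 : ℝ) (1 / 2), ∑' n : ℕ,
      ENNReal.ofReal (2 ^ n / ((2 * n + 1).factorial : ℝ)) *
        ENNReal.ofReal (x ^ (2 * n + 1) * ‖iteratedDeriv n f x‖ ^ 2) =
      ∫⁻ z, ‖square.indicator f z‖ₑ ^ 2 * diskKernel x z := by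
    intro x hx
    have hb := ball_subset_square ⟨hx.1, hx.2.le⟩
    rw [lintegral_diskKernel hx.1 hgm ((hf.congr hfg).mono hb)]
    refine tsum_congr fun n => ?_
    rw [hfg.iteratedDeriv_of_isOpen isOpen_square n
      (hb (Metric.mem_ball_self (div_pos hx.1 (by positivity))))]
  rw [setLIntegral_congr_fun measurableSet_Ioo h1, lintegral_lintegral_swap,
    ← lintegral_indicator hms]
  · refine lintegral_congr fun z => ?_
    rw [lintegral_const_mul' _ _ (by simp)]
    change _ * armWeight z = _
    by_cases hz : z ∈ square
    · rw [indicator_of_mem hz, indicator_of_mem hz]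
    · rw [indicator_of_notMem hz, indicator_of_notMem hz]
      simp
  · exact (((hgm.comp measurable_snd).enorm.pow_const 2).mul measurable_diskKernel).aemeasurable

/-! ### Rotations and the two-sided estimate -/

/-- The rotation by `u` about the centre of the square. -/
noncomputable def rot (u z : ℂ) : ℂ := 1 / 2 + u * (z - 1 / 2)

/-- The four rotations that preserve the square. -/
noncomputable def turn : Fin 4 → ℂ := ![1, -1, -Complex.I, Complex.I]

lemma norm_turn (j : Fin 4) : ‖turn j‖ = 1 := by
  fin_cases j <;> simp [turn]

lemma turn_ne_zero (j : Fin 4) : turn j ≠ 0 := by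
  rw [← norm_pos_iff, norm_turn]
  exact one_pos

lemma rot_inv_rot {u : ℂ} (hu : u ≠ 0) (z : ℂ) : rot u⁻¹ (rot u z) = z := by
  unfold rot
  field_simp
  ring

lemma rot_rot_inv {u : ℂ} (hu : u ≠ 0) (z : ℂ) : rot u (rot u⁻¹ z) = z := by
  unfold rot
  field_simp
  ring

lemma differentiable_rot (u : ℂ) : Differentiable ℂ (rot u) := by
  unfold rot
  fun_prop

lemma mem_square_iff {z : ℂ} : z ∈ square ↔ |(z - 1 / 2).re| + |(z - 1 / 2).im| < 1 / 2 := by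
  simp [square]

lemma rot_sub_half (u z : ℂ) : rot u z - 1 / 2 = u * (z - 1 / 2) := by
  unfold rot
  ring

lemma rot_turn_mem_square_iff (j : Fin 4) (z : ℂ) : rot (turn j) z ∈ square ↔ z ∈ square := by
  rw [mem_square_iff, mem_square_iff, rot_sub_half]
  fin_cases j <;> simp [turn, add_comm, abs_sub_comm]

lemma measurePreserving_rot {u : ℂ} (hu : ‖u‖ = 1) : MeasurePreserving (rot u) := by
  have h := (rotation ⟨u, mem_sphere_zero_iff_norm.2 hu⟩).measurePreserving
  exact (measurePreserving_add_left volume (1 / 2 : ℂ)).comp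
    (h.comp (measurePreserving_sub_right volume (1 / 2 : ℂ)))

lemma injective_rot {u : ℂ} (hu : u ≠ 0) : Function.Injective (rot u) :=
  (Function.LeftInverse.injective (rot_inv_rot hu))

lemma setLIntegral_rot_turn (j : Fin 4) (g : ℂ → ℝ≥0∞) :
    ∫⁻ z in square, g (rot (turn j) z) = ∫⁻ z in square, g z := by
  have h := (measurePreserving_rot (norm_turn j)).setLIntegral_comp_preimage_emb
    ((differentiable_rot _).continuous.measurableEmbedding (injective_rot (turn_ne_zero j)))
    g square
  rwa [show rot (turn j) ⁻¹' square = square from ext fun z => rot_turn_mem_square_iff j z] at h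

/-- The lines `|Im z| = |Re z - 1/2|` cut the square into four quarters permuted by the rotations;
the dominant coordinate and its sign choose `j`. -/
lemma exists_rot_inv_mem_leftQuarter {z : ℂ} (hz : z ∈ square) :
    ∃ j, rot (turn j)⁻¹ z ∈ leftQuarter := by
  have hsq : ∀ j, rot (turn j)⁻¹ z ∈ square := fun j => by
    rwa [← rot_turn_mem_square_iff j, rot_rot_inv (turn_ne_zero j)]
  suffices ∃ j, |(rot (turn j)⁻¹ z).im| ≤ 1 / 2 - (rot (turn j)⁻¹ z).re from
    this.imp fun j hj => ⟨hsq j, hj⟩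
  rcases le_total |z.im| |z.re - 1 / 2| with h | h
  · rcases abs_cases (z.re - 1 / 2) with ⟨h1, _⟩ | ⟨h1, _⟩
    · refine ⟨1, ?_⟩
      rw [h1] at h
      norm_num [rot, show turn 1 = -1 from rfl, abs_sub_comm] at h ⊢
      linarith
    · refine ⟨0, ?_⟩
      rw [h1] at h
      norm_num [rot, show turn 0 = 1 from rfl, abs_sub_comm] at h ⊢
      linarith
  · rcases abs_cases (z.im) with ⟨h1, _⟩ | ⟨h1, _⟩
    · refine ⟨2, ?_⟩
      rw [h1] at h
      norm_num [rot, show turn 2 = -Complex.I from rfl, abs_sub_comm] at h ⊢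
      linarith
    · refine ⟨3, ?_⟩
      rw [h1] at h
      norm_num [rot, show turn 3 = Complex.I from rfl, abs_sub_comm] at h ⊢
      linarith

lemma differentiableOn_comp_rot_turn {f : ℂ → ℂ} (hf : DifferentiableOn ℂ f square) (j : Fin 4) :
    DifferentiableOn ℂ (fun z => f (rot (turn j) z)) square :=
  hf.comp (differentiable_rot _).differentiableOn fun z hz => (rot_turn_mem_square_iff j z).2 hz

lemma sum_armSum_eq_lintegral {f : ℂ → ℂ} (hf : DifferentiableOn ℂ f square) :
    ∑ j, armSum (fun n x => iteratedDeriv n (fun z => f (rot (turn j) z)) x) =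
      ∫⁻ z in square, ‖f z‖ₑ ^ 2 * ∑ j, armWeight (rot (turn j)⁻¹ z) := by
  have hms := isOpen_square.measurableSet
  simp_rw [Finset.mul_sum]
  rw [lintegral_finsetSum']
  · refine Finset.sum_congr rfl fun j _ => ?_
    rw [armSum_eq_lintegral (differentiableOn_comp_rot_turn hf j),
      ← setLIntegral_rot_turn j (fun z => ‖f z‖ₑ ^ 2 * armWeight (rot (turn j)⁻¹ z))]
    simp only [rot_inv_rot (turn_ne_zero j)]
  · intro j _
    refine ((hf.continuousOn.aemeasurable hms).enorm.pow_const 2).mul ?_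
    exact (measurable_armWeight.comp (differentiable_rot _).continuous.measurable).aemeasurable

lemma sum_armSum_le {f : ℂ → ℂ} (hf : DifferentiableOn ℂ f square) :
    ∑ j, armSum (fun n x => iteratedDeriv n (fun z => f (rot (turn j) z)) x) ≤
      4 * bergmanNormSq f := by
  rw [sum_armSum_eq_lintegral hf, bergmanNormSq, ← lintegral_const_mul' _ _ (by simp)]
  refine lintegral_mono fun z => ?_
  rw [mul_comm (4 : ℝ≥0∞)]
  gcongr
  calc ∑ j, armWeight (rot (turn j)⁻¹ z) ≤ ∑ _j : Fin 4, 1 :=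
        Finset.sum_le_sum fun j _ => armWeight_le_one _
    _ = 4 := by simp

lemma le_sum_armSum {f : ℂ → ℂ} (hf : DifferentiableOn ℂ f square) :
    1 / 4 * bergmanNormSq f ≤
      ∑ j, armSum (fun n x => iteratedDeriv n (fun z => f (rot (turn j) z)) x) := by
  rw [sum_armSum_eq_lintegral hf, bergmanNormSq, ← lintegral_const_mul' _ _ (by simp)]
  refine setLIntegral_mono' isOpen_square.measurableSet fun z hz => ?_
  obtain ⟨j, hj⟩ := exists_rot_inv_mem_leftQuarter hz
  rw [mul_comm (1 / 4 : ℝ≥0∞)]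
  gcongr
  exact (quarter_le_armWeight hj).trans
    (Finset.single_le_sum (f := fun j => armWeight (rot (turn j)⁻¹ z)) (fun _ _ => zero_le)
      (Finset.mem_univ j))

lemma armSum_congr {e e' : ℕ → ℝ → ℂ}
    (h : ∀ n, ∀ x ∈ Ioo (0 : ℝ) (1 / 2), ‖e n x‖ = ‖e' n x‖) : armSum e = armSum e' := by
  unfold armSum
  refine tsum_congr fun n => ?_
  congr 1
  refine setLIntegral_congr_fun measurableSet_Ioo fun x hx => ?_
  simp only [h n x hx]

/-- The order of the entries of `turn` is that of the four points in the bracket. -/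
lemma diagonalSum_eq_sum_rot (d : ℕ → ℂ → ℂ) : diagonalSum d =
    ∑' n : ℕ, ENNReal.ofReal (2 ^ n / ((2 * n + 1).factorial : ℝ)) *
      ∫⁻ x : ℝ in Ioo (0 : ℝ) (1 / 2),
        ∑ j, ENNReal.ofReal (x ^ (2 * n + 1) * ‖d n (rot (turn j) x)‖ ^ 2) := by
  unfold diagonalSum
  refine tsum_congr fun n => ?_
  congr 1
  refine setLIntegral_congr_fun measurableSet_Ioo fun x hx => ?_
  have hx0 := hx.1
  have h0 : rot (turn 0) x = x := by simp [rot, turn]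
  have h1 : rot (turn 1) x = 1 - x := by simp [rot, turn]; ring
  have h2 : rot (turn 2) x = 1 / 2 + Complex.I * (1 / 2 - x) := by simp [rot, turn]; ring
  have h3 : rot (turn 3) x = 1 / 2 + Complex.I * (x - 1 / 2) := by simp [rot, turn]
  rw [Fin.sum_univ_four, h0, h1, h2, h3, ← ENNReal.ofReal_add (by positivity) (by positivity),
    ← ENNReal.ofReal_add (by positivity) (by positivity),
    ← ENNReal.ofReal_add (by positivity) (by positivity)]
  congr 1
  ring

lemma armSum_le_diagonalSum (d : ℕ → ℂ → ℂ) (j : Fin 4) :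
    armSum (fun n x => d n (rot (turn j) x)) ≤ diagonalSum d := by
  rw [diagonalSum_eq_sum_rot]
  unfold armSum
  gcongr with n x
  exact Finset.single_le_sum
    (f := fun j => ENNReal.ofReal (x ^ (2 * n + 1) * ‖d n (rot (turn j) x)‖ ^ 2))
    (fun _ _ => zero_le) (Finset.mem_univ j)

/-- Continuity supplies the measurability needed to split the integral of a sum; the inequality
`armSum_le_diagonalSum` does without it. -/
lemma diagonalSum_eq_sum_armSum {d : ℕ → ℂ → ℂ}
    (hd : ∀ n j, ContinuousOn (fun x : ℝ => ‖d n (rot (turn j) x)‖) (Ioo (0 : ℝ) (1 / 2))) :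
    diagonalSum d = ∑ j, armSum (fun n x => d n (rot (turn j) x)) := by
  rw [diagonalSum_eq_sum_rot]
  unfold armSum
  rw [← Summable.tsum_finsetSum fun _ _ => ENNReal.summable]
  refine tsum_congr fun n => ?_
  rw [lintegral_finsetSum', Finset.mul_sum]
  intro j _
  have := hd n j
  exact (ContinuousOn.aemeasurable (by fun_prop) measurableSet_Ioo).ennreal_ofReal

lemma iteratedDeriv_comp_rot (f : ℂ → ℂ) (u : ℂ) (n : ℕ) :
    iteratedDeriv n (fun z => f (rot u z)) = fun z => u ^ n * iteratedDeriv n f (rot u z) := by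
  induction n with
  | zero => simp
  | succ n ih =>
    funext z
    have h1 : ∀ z, rot u z = u * z + (1 / 2 - u / 2) := fun z => by unfold rot; ring
    have h2 : deriv (fun z => iteratedDeriv n f (rot u z)) z =
        u * deriv (iteratedDeriv n f) (rot u z) := by
      simp only [h1]
      rw [deriv_comp_mul_left u (fun w => iteratedDeriv n f (w + (1 / 2 - u / 2))),
        deriv_comp_add_const, smul_eq_mul]
    rw [iteratedDeriv_succ, ih, iteratedDeriv_succ, deriv_const_mul_field, h2]
    ring

lemma norm_iteratedDeriv_comp_rot_turn (f : ℂ → ℂ) (j : Fin 4) (n : ℕ) (z : ℂ) :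
    ‖iteratedDeriv n (fun z => f (rot (turn j) z)) z‖ = ‖iteratedDeriv n f (rot (turn j) z)‖ := by
  rw [iteratedDeriv_comp_rot, norm_mul, norm_pow, norm_turn, one_pow, one_mul]

lemma diagonalSum_iteratedDeriv {f : ℂ → ℂ} (hf : DifferentiableOn ℂ f square) :
    diagonalSum (fun n => iteratedDeriv n f) =
      ∑ j, armSum (fun n x => iteratedDeriv n (fun z => f (rot (turn j) z)) x) := by
  rw [diagonalSum_eq_sum_armSum]
  · refine Finset.sum_congr rfl fun j _ => armSum_congr fun n x _ => ?_
    rw [norm_iteratedDeriv_comp_rot_turn]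
  · intro n j
    simp only [← norm_iteratedDeriv_comp_rot_turn]
    exact (continuousOn_iteratedDeriv_ofReal (differentiableOn_comp_rot_turn hf j) n).norm

/-- The two-sided estimate, for every holomorphic function on the square. -/
theorem diagonalSum_bounds {f : ℂ → ℂ} (hf : DifferentiableOn ℂ f square) :
    1 / 4 * bergmanNormSq f ≤ diagonalSum (fun n => iteratedDeriv n f) ∧
      diagonalSum (fun n => iteratedDeriv n f) ≤ 4 * bergmanNormSq f := by
  rw [diagonalSum_iteratedDeriv hf]
  exact ⟨le_sum_armSum hf, sum_armSum_le hf⟩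

/-! ### Gluing local functions -/

lemma exists_eqOn_of_compatible {ι α β : Type*} [Nonempty β] {s : ι → Set α} {H : ι → α → β}
    (h : ∀ i j, EqOn (H i) (H j) (s i ∩ s j)) : ∃ F : α → β, ∀ i, EqOn F (H i) (s i) := by
  classical
  refine ⟨fun z => if hz : ∃ i, z ∈ s i then H hz.choose z else Classical.arbitrary β,
    fun i z hz => ?_⟩
  have hex : ∃ i, z ∈ s i := ⟨i, hz⟩
  simp only [dif_pos hex]
  exact h _ _ ⟨hex.choose_spec, hz⟩

lemma differentiableOn_iUnion_of_eqOn {ι : Type*} {s : ι → Set ℂ} {H : ι → ℂ → ℂ} {F : ℂ → ℂ}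
    (hs : ∀ i, IsOpen (s i)) (hH : ∀ i, DifferentiableOn ℂ (H i) (s i))
    (h : ∀ i, EqOn F (H i) (s i)) : DifferentiableOn ℂ F (⋃ i, s i) := by
  intro z hz
  obtain ⟨i, hi⟩ := mem_iUnion.1 hz
  exact (((hH i).congr (h i)).differentiableAt ((hs i).mem_nhds hi)).differentiableWithinAt

/-! ### Taylor remainders controlled by the arm sum -/

/-- From `choose (2m) m ≤ 4^m`. Up to a linear factor, `2^m / (2m+1)!` is thus at least `2^(-m) /
(m!)²`, which is where the radius `x / √2` comes from. -/
lemma factorial_two_mul_add_one_le (m : ℕ) :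
    ((2 * m + 1).factorial : ℝ) ≤ (2 * m + 1) * 4 ^ m * (m.factorial : ℝ) ^ 2 := by
  have h1 : (2 * m).factorial = (2 * m).choose m * (m.factorial * m.factorial) := by
    have := Nat.choose_mul_factorial_mul_factorial (show m ≤ 2 * m by omega)
    rw [show 2 * m - m = m by omega] at this
    rw [← this]
    ring
  have h2 : (2 * m).choose m ≤ 4 ^ m := by
    have := Nat.choose_le_two_pow (2 * m) m
    rwa [pow_mul] at this
  have h3 : (2 * m + 1).factorial ≤ (2 * m + 1) * 4 ^ m * m.factorial ^ 2 := by
    rw [Nat.factorial_succ, h1, mul_assoc, sq]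
    gcongr
  exact_mod_cast h3

lemma tendsto_cubic_mul_geometric {q : ℝ} (hq : 0 ≤ q) (hq1 : q < 1) :
    Tendsto (fun n : ℕ => ((n : ℝ) + 1) ^ 2 * (2 * n + 3) * q ^ n) atTop (𝓝 0) := by
  have habs : |q| < 1 := by rwa [abs_of_nonneg hq]
  have h := fun k => tendsto_pow_const_mul_const_pow_of_abs_lt_one k habs
  have := ((((h 3).const_mul 2).add ((h 2).const_mul 7)).add ((h 1).const_mul 8)).add
    ((h 0).const_mul 3)
  simp only [mul_zero, add_zero] at this
  refine this.congr fun n => ?_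
  ring

lemma term_le_armSum (e : ℕ → ℝ → ℂ) (m : ℕ) :
    ENNReal.ofReal (2 ^ m / ((2 * m + 1).factorial : ℝ)) *
      ∫⁻ x : ℝ in Ioo (0 : ℝ) (1 / 2), ENNReal.ofReal (x ^ (2 * m + 1) * ‖e m x‖ ^ 2) ≤
      armSum e :=
  ENNReal.le_tsum (f := fun m => ENNReal.ofReal (2 ^ m / ((2 * m + 1).factorial : ℝ)) *
      ∫⁻ x : ℝ in Ioo (0 : ℝ) (1 / 2), ENNReal.ofReal (x ^ (2 * m + 1) * ‖e m x‖ ^ 2)) m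

lemma uIcc_subset_Ioo {a b x y : ℝ} (hx : x ∈ Ioo a b) (hy : y ∈ Ioo a b) :
    uIcc x y ⊆ Ioo a b := fun _ ht =>
  ⟨(lt_min hx.1 hy.1).trans_le ht.1, ht.2.trans_lt (max_lt hx.2 hy.2)⟩

/-- One term of the sum is kept, and its weight `t^(2m+1)` is at least `α^(2m+1)` between `x` and
`y`. -/
lemma integral_sq_norm_le_armSum {e : ℕ → ℝ → ℂ} (he : armSum e < ⊤) {m : ℕ}
    (hc : ContinuousOn (e m) (Ioo (0 : ℝ) (1 / 2))) {x y α : ℝ} (hα : 0 < α)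
    (hx : x ∈ Ioo (0 : ℝ) (1 / 2)) (hy : y ∈ Ioo (0 : ℝ) (1 / 2)) (hαx : α ≤ x) (hαy : α ≤ y) :
    2 ^ m / ((2 * m + 1).factorial : ℝ) * α ^ (2 * m + 1) * ∫ t in uIoc x y, ‖e m t‖ ^ 2 ≤
      (armSum e).toReal := by
  have hsub := uIcc_subset_Ioo hx hy
  have hint : IntegrableOn (fun t => ‖e m t‖ ^ 2) (uIoc x y) :=
    (((hc.mono hsub).norm.pow 2).integrableOn_compact isCompact_uIcc).mono_set uIoc_subset_uIcc
  rw [← ENNReal.ofReal_le_iff_le_toReal he.ne, ENNReal.ofReal_mul (by positivity),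
    ofReal_integral_eq_lintegral_ofReal hint (Eventually.of_forall fun t => by positivity),
    ENNReal.ofReal_mul (by positivity), mul_assoc]
  refine le_trans ?_ (term_le_armSum e m)
  gcongr
  rw [← lintegral_const_mul' _ _ ENNReal.ofReal_ne_top]
  calc ∫⁻ t in uIoc x y, ENNReal.ofReal (α ^ (2 * m + 1)) * ENNReal.ofReal (‖e m t‖ ^ 2)
      ≤ ∫⁻ t in uIoc x y, ENNReal.ofReal (t ^ (2 * m + 1) * ‖e m t‖ ^ 2) := by
        refine setLIntegral_mono' measurableSet_uIoc fun t ht => ?_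
        rw [← ENNReal.ofReal_mul (by positivity)]
        have : α ≤ t := (le_min hαx hαy).trans (uIoc_subset_uIcc ht).1
        gcongr
    _ ≤ _ := lintegral_mono_set (uIoc_subset_uIcc.trans hsub)

lemma ContDiffOn.continuousOn_iteratedDeriv_Ioo {g : ℝ → ℂ} {a b : ℝ}
    (hg : ContDiffOn ℝ ∞ g (Ioo a b)) (n : ℕ) : ContinuousOn (iteratedDeriv n g) (Ioo a b) :=
  (hg.continuousOn_iteratedDerivWithin (m := n) (by exact_mod_cast le_top)
    (uniqueDiffOn_Ioo _ _)).congr fun _ ht => (iteratedDerivWithin_of_isOpen isOpen_Ioo ht).symm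

/-- The Taylor polynomials of `g` at `x` converge to `g` near `x`. -/
lemma tendsto_taylor_of_armSum_lt_top {g : ℝ → ℂ} (hg : ContDiffOn ℝ ∞ g (Ioo 0 (1 / 2)))
    (hfin : armSum (fun n x => iteratedDeriv n g x) < ⊤) {x y α : ℝ} (hα : 0 < α)
    (hx : x ∈ Ioo (0 : ℝ) (1 / 2)) (hy : y ∈ Ioo (0 : ℝ) (1 / 2)) (hαx : α ≤ x) (hαy : α ≤ y)
    (hd : |y - x| < α / Real.sqrt 2) :
    Tendsto (fun n : ℕ => ∑ k ∈ Finset.range (n + 1),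
      (((k.factorial : ℝ)⁻¹ * (y - x) ^ k) • iteratedDeriv k g x)) atTop (𝓝 (g y)) := by
  rcases eq_or_ne x y with rfl | hxy
  · simp [Finset.sum_range_succ']
  have hsub := uIcc_subset_Ioo hx hy
  have hu : UniqueDiffOn ℝ (uIcc x y) := uniqueDiffOn_uIcc hxy
  have hat : ∀ t ∈ uIcc x y, ContDiffAt ℝ ∞ g t := fun t ht =>
    hg.contDiffAt (isOpen_Ioo.mem_nhds (hsub ht))
  have hder : ∀ (n : ℕ), ∀ t ∈ uIcc x y,
      iteratedDerivWithin n g (uIcc x y) t = iteratedDeriv n g t := fun n t ht =>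
    iteratedDerivWithin_eq_iteratedDeriv hu ((hat t ht).of_le (by exact_mod_cast le_top)) ht
  have hcont := hg.continuousOn_iteratedDeriv_Ioo
  -- The `+ 1` keeps `M`, hence `A` below, positive, so that division by `√A` is allowed.
  set M := (armSum (fun n x => iteratedDeriv n g x)).toReal + 1 with hM
  have hM0 : 0 < M := by positivity
  set d := |y - x| with hd'
  have hd0 : 0 ≤ d := abs_nonneg _
  have hd1 : d ≤ 1 := by
    rw [hd', abs_le]
    constructor <;> linarith [hx.1, hx.2, hy.1, hy.2]
  -- The ratio of the final geometric bound; `q < 1` is exactly `|y - x| < α / √2`.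
  set q := 2 * d ^ 2 / α ^ 2 with hq
  have hq0 : 0 ≤ q := by positivity
  have hq1 : q < 1 := by
    rw [hq, div_lt_one (by positivity)]
    have : d ^ 2 < (α / Real.sqrt 2) ^ 2 := by gcongr
    rw [div_pow, Real.sq_sqrt (by norm_num)] at this
    linarith
  have hrem : ∀ n : ℕ, ‖g y - ∑ k ∈ Finset.range (n + 1),
      (((k.factorial : ℝ)⁻¹ * (y - x) ^ k) • iteratedDeriv k g x)‖ ≤
      Real.sqrt (2 * M / α ^ 3 * (((n : ℝ) + 1) ^ 2 * (2 * n + 3) * q ^ n)) := by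
    intro n
    have htay := taylor_integral_remainder (f := g) (x := y) (x₀ := x) (n := n)
      ((hg.mono hsub).of_le (by exact_mod_cast le_top))
    rw [taylor_within_apply] at htay
    simp only [hder _ x left_mem_uIcc] at htay
    rw [htay]
    set A := M * (2 * (n + 1) + 1).factorial / (2 ^ (n + 1) * α ^ (2 * (n + 1) + 1)) with hA
    have hA0 : 0 < A := by positivity
    have hI : ∫ t in uIoc x y, ‖iteratedDeriv (n + 1) g t‖ ^ 2 ≤ A := by
      have := integral_sq_norm_le_armSum (e := fun n x => iteratedDeriv n g x) hfin
        (hcont (n + 1)) hα hx hy hαx hαy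
      rw [hA, le_div_iff₀ (by positivity)]
      have h2 : 2 ^ (n + 1) / ((2 * (n + 1) + 1).factorial : ℝ) * α ^ (2 * (n + 1) + 1) *
        ∫ t in uIoc x y, ‖iteratedDeriv (n + 1) g t‖ ^ 2 ≤ M := this.trans (by rw [hM]; linarith)
      rw [div_mul_eq_mul_div, div_mul_eq_mul_div, div_le_iff₀ (by positivity)] at h2
      linarith
    have hvol : volume.real (uIoc x y) = d := by
      rw [Measure.real, Real.volume_uIoc, ENNReal.toReal_ofReal hd0]
    have hcst : IntegrableOn (fun _ : ℝ => Real.sqrt A) (uIoc x y) :=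
      integrableOn_const (by rw [Real.volume_uIoc]; exact ENNReal.ofReal_ne_top)
    have hint : IntegrableOn (fun t => ‖iteratedDeriv (n + 1) g t‖ ^ 2) (uIoc x y) :=
      ((((hcont (n + 1)).mono hsub).norm.pow 2).integrableOn_compact isCompact_uIcc).mono_set
        uIoc_subset_uIcc
    have hle : ‖∫ t in x..y, ((y - t) ^ n / n.factorial) •
        iteratedDerivWithin (n + 1) g (uIcc x y) t‖ ≤ d ^ n / n.factorial * Real.sqrt A := by
      refine intervalIntegral.norm_integral_le_integral_norm_uIoc.trans ?_
      -- In place of Cauchy–Schwarz: `2b ≤ √A + b² / √A`, integrated using `∫ b² ≤ A` and `d ≤ 1`.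
      have hpt : ∀ t ∈ uIoc x y, ‖((y - t) ^ n / n.factorial) •
          iteratedDerivWithin (n + 1) g (uIcc x y) t‖ ≤ d ^ n / n.factorial *
            ((Real.sqrt A + ‖iteratedDeriv (n + 1) g t‖ ^ 2 / Real.sqrt A) / 2) := by
        intro t ht
        have ht' := uIoc_subset_uIcc ht
        rw [hder _ t ht', norm_smul, norm_div, norm_pow, Real.norm_eq_abs, Real.norm_natCast]
        have h1 : |y - t| ≤ d := by
          exact abs_sub_right_of_mem_uIcc ht'
        gcongr
        have hs : 0 < Real.sqrt A := Real.sqrt_pos.2 hA0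
        rw [le_div_iff₀ (by norm_num), ← sub_nonneg]
        have : Real.sqrt A + ‖iteratedDeriv (n + 1) g t‖ ^ 2 / Real.sqrt A -
          ‖iteratedDeriv (n + 1) g t‖ * 2 =
          (Real.sqrt A - ‖iteratedDeriv (n + 1) g t‖) ^ 2 / Real.sqrt A := by
          field_simp
          ring
        rw [this]
        positivity
      calc _ ≤ ∫ t in uIoc x y, d ^ n / n.factorial *
            ((Real.sqrt A + ‖iteratedDeriv (n + 1) g t‖ ^ 2 / Real.sqrt A) / 2) := by
            refine setIntegral_mono_on ?_ (((hcst.add (hint.div_const _)).div_const 2).const_mul _)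
              measurableSet_uIoc hpt
            refine (ContinuousOn.integrableOn_compact isCompact_uIcc ?_).mono_set uIoc_subset_uIcc
            have h1 : ContinuousOn (iteratedDerivWithin (n + 1) g (uIcc x y)) (uIcc x y) :=
              ((hcont (n + 1)).mono hsub).congr (hder (n + 1))
            fun_prop
        _ = d ^ n / n.factorial * ((Real.sqrt A * d +
            (∫ t in uIoc x y, ‖iteratedDeriv (n + 1) g t‖ ^ 2) / Real.sqrt A) / 2) := by
            rw [integral_const_mul, integral_div, integral_add hcst (hint.div_const _), integral_div,
              setIntegral_const, hvol, smul_eq_mul, mul_comm d]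
        _ ≤ d ^ n / n.factorial * ((Real.sqrt A * 1 + A / Real.sqrt A) / 2) := by gcongr
        _ = _ := by
          rw [Real.div_sqrt]
          ring
    refine hle.trans (Real.le_sqrt_of_sq_le ?_)
    rw [mul_pow, Real.sq_sqrt hA0.le, hA]
    have hf := factorial_two_mul_add_one_le (n + 1)
    calc (d ^ n / n.factorial) ^ 2 *
          (M * (2 * (n + 1) + 1).factorial / (2 ^ (n + 1) * α ^ (2 * (n + 1) + 1)))
        ≤ (d ^ n / n.factorial) ^ 2 *
          (M * ((2 * ((n + 1 : ℕ) : ℝ) + 1) * 4 ^ (n + 1) * ((n + 1).factorial : ℝ) ^ 2) /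
            (2 ^ (n + 1) * α ^ (2 * (n + 1) + 1))) := by gcongr
      _ = 2 * M / α ^ 3 * (((n : ℝ) + 1) ^ 2 * (2 * n + 3) * q ^ n) := by
        have h4 : (4 : ℝ) ^ (n + 1) = 2 ^ (n + 1) * 2 ^ (n + 1) := by rw [← mul_pow]; norm_num
        have hqn : q ^ n = 2 ^ n * (d ^ n) ^ 2 / (α ^ n) ^ 2 := by
          rw [hq, div_pow, mul_pow]
          ring
        have hαn : α ^ (2 * (n + 1) + 1) = (α ^ n) ^ 2 * α ^ 3 := by ring
        rw [hqn, hαn, h4, Nat.factorial_succ]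
        push_cast
        field_simp
        ring
  rw [tendsto_iff_norm_sub_tendsto_zero]
  have hlim := (((tendsto_cubic_mul_geometric hq0 hq1).const_mul (2 * M / α ^ 3)).sqrt)
  rw [mul_zero, Real.sqrt_zero] at hlim
  refine squeeze_zero (fun n => norm_nonneg _) (fun n => ?_) hlim
  rw [norm_sub_rev]
  exact hrem n

/-! ### Convergent Taylor series and real analyticity -/

/-- The sum of the Taylor series of `g` at `x`, at a complex point. -/
noncomputable def taylorSum (g : ℝ → ℂ) (x : ℝ) (z : ℂ) : ℂ :=
  ∑' n : ℕ, (n.factorial : ℂ)⁻¹ * iteratedDeriv n g x * (z - x) ^ n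

/-- The Taylor series of `g` at `x` converges in the disc of radius `x / √2`. -/
def ConvergesOnDisk (g : ℝ → ℂ) (x : ℝ) : Prop :=
  ∀ r, 0 ≤ r → r < x / Real.sqrt 2 →
    Summable fun n : ℕ => ‖(n.factorial : ℂ)⁻¹ * iteratedDeriv n g x‖ * r ^ n

/-- Each term is at most the sum `S`, so for `r < ρ < x / √2` the squared Taylor terms at radius `ρ`
are at most `(S/x) (2n+1) q^n` with `q = 2ρ²/x² < 1`. They are bounded, and comparison with
`(r/ρ)^n` concludes. -/
lemma convergesOnDisk_of_tsum_lt_top {g : ℝ → ℂ} {x : ℝ} (hx : 0 < x)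
    (h : ∑' n : ℕ, ENNReal.ofReal (2 ^ n / ((2 * n + 1).factorial : ℝ)) *
        ENNReal.ofReal (x ^ (2 * n + 1) * ‖iteratedDeriv n g x‖ ^ 2) < ⊤) :
    ConvergesOnDisk g x := by
  intro r hr hrR
  obtain ⟨ρ, hrρ, hρR⟩ := exists_between hrR
  have hρ : 0 < ρ := hr.trans_lt hrρ
  set S := (∑' n : ℕ, ENNReal.ofReal (2 ^ n / ((2 * n + 1).factorial : ℝ)) *
        ENNReal.ofReal (x ^ (2 * n + 1) * ‖iteratedDeriv n g x‖ ^ 2)).toReal with hS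
  have hS0 : 0 ≤ S := ENNReal.toReal_nonneg
  have hterm : ∀ n : ℕ, 2 ^ n / ((2 * n + 1).factorial : ℝ) *
      (x ^ (2 * n + 1) * ‖iteratedDeriv n g x‖ ^ 2) ≤ S := by
    intro n
    rw [hS, ← ENNReal.ofReal_le_iff_le_toReal h.ne, ENNReal.ofReal_mul (by positivity)]
    exact ENNReal.le_tsum n
  set q := 2 * ρ ^ 2 / x ^ 2 with hq
  have hq0 : 0 ≤ q := by positivity
  have hq1 : q < 1 := by
    rw [hq, div_lt_one (by positivity)]
    have : ρ ^ 2 < (x / Real.sqrt 2) ^ 2 := by gcongr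
    rw [div_pow, Real.sq_sqrt (by norm_num)] at this
    linarith
  obtain ⟨K, hK⟩ := (tendsto_cubic_mul_geometric hq0 hq1).bddAbove_range
  have hbound : ∀ n : ℕ, ‖(n.factorial : ℂ)⁻¹ * iteratedDeriv n g x‖ * ρ ^ n ≤
      Real.sqrt (S / x * K) := by
    intro n
    refine Real.le_sqrt_of_sq_le ?_
    have hKn : ((n : ℝ) + 1) ^ 2 * (2 * n + 3) * q ^ n ≤ K := hK ⟨n, rfl⟩
    have h1 : (2 * (n : ℝ) + 1) * q ^ n ≤ K := by
      refine le_trans ?_ hKn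
      gcongr
      nlinarith [(Nat.cast_nonneg n : (0 : ℝ) ≤ n)]
    have hf := factorial_two_mul_add_one_le n
    have ht := hterm n
    set b := ‖iteratedDeriv n g x‖ with hb
    have h2 : b ^ 2 ≤ S * ((2 * n + 1) * 4 ^ n * (n.factorial : ℝ) ^ 2) /
        (2 ^ n * x ^ (2 * n + 1)) := by
      rw [le_div_iff₀ (by positivity)]
      rw [div_mul_eq_mul_div, div_le_iff₀ (by positivity)] at ht
      calc _ = 2 ^ n * (x ^ (2 * n + 1) * b ^ 2) := by ring
        _ ≤ S * ((2 * n + 1).factorial : ℝ) := ht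
        _ ≤ _ := by gcongr
    have hnorm : ‖(n.factorial : ℂ)⁻¹ * iteratedDeriv n g x‖ = b / n.factorial := by
      rw [norm_mul, norm_inv, Complex.norm_natCast, ← hb]
      field_simp
    rw [hnorm]
    calc (b / n.factorial * ρ ^ n) ^ 2 = b ^ 2 * ((ρ ^ n) ^ 2 / (n.factorial : ℝ) ^ 2) := by
          field_simp
      _ ≤ S * ((2 * n + 1) * 4 ^ n * (n.factorial : ℝ) ^ 2) /
        (2 ^ n * x ^ (2 * n + 1)) * ((ρ ^ n) ^ 2 / (n.factorial : ℝ) ^ 2) := by gcongr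
      _ = S / x * ((2 * n + 1) * q ^ n) := by
        have h4 : (4 : ℝ) ^ n = 2 ^ n * 2 ^ n := by rw [← mul_pow]; norm_num
        have hqn : q ^ n = 2 ^ n * (ρ ^ n) ^ 2 / (x ^ n) ^ 2 := by
          rw [hq, div_pow, mul_pow]
          ring
        have hxn : x ^ (2 * n + 1) = (x ^ n) ^ 2 * x := by ring
        rw [hqn, hxn, h4]
        field_simp
      _ ≤ S / x * K := by gcongr
  have hgeom : Summable fun n : ℕ => Real.sqrt (S / x * K) * (r / ρ) ^ n :=
    (summable_geometric_of_lt_one (by positivity) ((div_lt_one hρ).2 hrρ)).mul_left _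
  refine Summable.of_nonneg_of_le (fun n => by positivity) (fun n => ?_) hgeom
  calc _ = ‖(n.factorial : ℂ)⁻¹ * iteratedDeriv n g x‖ * ρ ^ n * (r / ρ) ^ n := by
        rw [div_pow]
        field_simp
    _ ≤ _ := by gcongr; exact hbound n

lemma ConvergesOnDisk.hasSum {g : ℝ → ℂ} {x : ℝ} (h : ConvergesOnDisk g x) {z : ℂ}
    (hz : z ∈ Metric.ball (x : ℂ) (x / Real.sqrt 2)) :
    HasSum (fun n : ℕ => (n.factorial : ℂ)⁻¹ * iteratedDeriv n g x * (z - x) ^ n)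
      (taylorSum g x z) := by
  rw [mem_ball_iff_norm] at hz
  have := h ‖z - x‖ (norm_nonneg _) hz
  refine (Summable.of_norm ?_).hasSum
  simpa only [norm_mul, norm_pow] using this

lemma ConvergesOnDisk.differentiableOn {g : ℝ → ℂ} {x : ℝ} (h : ConvergesOnDisk g x) :
    DifferentiableOn ℂ (taylorSum g x) (Metric.ball (x : ℂ) (x / Real.sqrt 2)) := by
  intro z hz
  rw [mem_ball_iff_norm] at hz
  obtain ⟨r, hzr, hrR⟩ := exists_between hz
  have hsum := h r ((norm_nonneg _).trans hzr.le) hrR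
  have hd : DifferentiableOn ℂ (taylorSum g x) (Metric.ball (x : ℂ) r) := by
    refine Complex.differentiableOn_tsum_of_summable_norm hsum (fun n => by fun_prop)
      Metric.isOpen_ball fun n w hw => ?_
    rw [mem_ball_iff_norm] at hw
    rw [norm_mul, norm_pow]
    gcongr
  exact (hd.differentiableAt (Metric.isOpen_ball.mem_nhds
    (mem_ball_iff_norm.2 hzr))).differentiableWithinAt

/-- By Tonelli the pointwise sum is finite for almost every `x`, and a set of full measure meets
every nonempty open set. -/
lemma exists_convergesOnDisk {g : ℝ → ℂ} (hg : ContDiffOn ℝ ∞ g (Ioo 0 (1 / 2)))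
    (hfin : armSum (fun n x => iteratedDeriv n g x) < ⊤) {V : Set ℝ} (hV : IsOpen V)
    (hne : (V ∩ Ioo 0 (1 / 2)).Nonempty) : ∃ x ∈ V ∩ Ioo 0 (1 / 2), ConvergesOnDisk g x := by
  have hcont := hg.continuousOn_iteratedDeriv_Ioo
  rw [armSum_eq_lintegral_tsum hcont] at hfin
  have hae := ae_lt_top' (AEMeasurable.tsum fun n => by
    have := hcont n
    exact (AEMeasurable.ennreal_ofReal
      (ContinuousOn.aemeasurable (by fun_prop) measurableSet_Ioo)).const_mul _) hfin.ne
  rw [ae_restrict_iff' measurableSet_Ioo] at hae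
  obtain ⟨x, hxV, hx⟩ := (Measure.dense_of_ae hae).inter_open_nonempty _ (hV.inter isOpen_Ioo) hne
  exact ⟨x, hxV, convergesOnDisk_of_tsum_lt_top hxV.2.1 (hx hxV.2)⟩

lemma ofReal_mem_ball {x t r : ℝ} : (t : ℂ) ∈ Metric.ball (x : ℂ) r ↔ |t - x| < r := by
  rw [mem_ball_iff_norm, ← Complex.ofReal_sub, Complex.norm_real, Real.norm_eq_abs]

/-- The same Taylor polynomials converge to `g y` by the remainder estimate and to `taylorSum g x y`
by convergence in the disc. -/
lemma taylorSum_eq {g : ℝ → ℂ} (hg : ContDiffOn ℝ ∞ g (Ioo 0 (1 / 2)))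
    (hfin : armSum (fun n x => iteratedDeriv n g x) < ⊤) {x y α : ℝ} (hconv : ConvergesOnDisk g x)
    (hα : 0 < α) (hx : x ∈ Ioo (0 : ℝ) (1 / 2)) (hy : y ∈ Ioo (0 : ℝ) (1 / 2)) (hαx : α ≤ x)
    (hαy : α ≤ y) (hd : |y - x| < α / Real.sqrt 2) : taylorSum g x y = g y := by
  have h1 := tendsto_taylor_of_armSum_lt_top hg hfin hα hx hy hαx hαy hd
  have hmem : (y : ℂ) ∈ Metric.ball (x : ℂ) (x / Real.sqrt 2) :=
    ofReal_mem_ball.2 (hd.trans_le (by gcongr))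
  have h2 := (hconv.hasSum hmem).tendsto_sum_nat.comp (tendsto_add_atTop_nat 1)
  refine tendsto_nhds_unique h2 (h1.congr fun n => ?_)
  refine Finset.sum_congr rfl fun k _ => ?_
  rw [Complex.real_smul]
  push_cast
  ring

lemma AnalyticAt.comp_ofReal_real {F : ℂ → ℂ} {t : ℝ} (h : AnalyticAt ℂ F t) :
    AnalyticAt ℝ (fun s : ℝ => F s) t :=
  AnalyticAt.fun_comp (f := fun s : ℝ => (s : ℂ)) (h.restrictScalars (𝕜 := ℝ))
    (Complex.ofRealCLM.analyticAt t)

/-- Points of the window `(7y/8, 9y/8)` differ by less than `y/4`, so `α = 7y/8` is admissible for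
any two of them. -/
lemma seven_eighths_bound {y : ℝ} (hy : 0 < y) : y / 4 ≤ 7 / 8 * y / Real.sqrt 2 := by
  have : Real.sqrt 2 ≤ 2 := by
    rw [Real.sqrt_le_left (by norm_num)]
    norm_num
  rw [le_div_iff₀ (by positivity)]
  nlinarith

/-- The Taylor series at `y` itself is not known to converge, so `g` is represented near `y` by the
series at a good centre `x` close by. -/
lemma analyticAt_of_armSum_lt_top {g : ℝ → ℂ} (hg : ContDiffOn ℝ ∞ g (Ioo 0 (1 / 2)))
    (hfin : armSum (fun n x => iteratedDeriv n g x) < ⊤) {y : ℝ} (hy : y ∈ Ioo (0 : ℝ) (1 / 2)) :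
    AnalyticAt ℝ g y := by
  have hy0 := hy.1
  have hV : IsOpen (Ioo (7 / 8 * y) (9 / 8 * y)) := isOpen_Ioo
  have hyV : y ∈ Ioo (7 / 8 * y) (9 / 8 * y) := ⟨by linarith, by linarith⟩
  obtain ⟨x, ⟨hxV, hx⟩, hconv⟩ := exists_convergesOnDisk hg hfin hV ⟨y, hyV, hy⟩
  have hb := seven_eighths_bound hy0
  have hclose : ∀ t ∈ Ioo (7 / 8 * y) (9 / 8 * y), |t - x| < 7 / 8 * y / Real.sqrt 2 := by
    intro t ht
    refine lt_of_lt_of_le ?_ hb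
    rw [abs_lt]
    constructor <;> linarith [ht.1, ht.2, hxV.1, hxV.2]
  have heq : (fun t : ℝ => taylorSum g x t) =ᶠ[𝓝 y] g := by
    filter_upwards [hV.mem_nhds hyV, isOpen_Ioo.mem_nhds hy] with t ht ht'
    exact taylorSum_eq hg hfin hconv (by positivity) hx ht' hxV.1.le ht.1.le (hclose t ht)
  have hmem : (y : ℂ) ∈ Metric.ball (x : ℂ) (x / Real.sqrt 2) := by
    refine ofReal_mem_ball.2 ((hclose y hyV).trans_le ?_)
    gcongr
    exact hxV.1.le
  exact ((hconv.differentiableOn.analyticAt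
    (Metric.isOpen_ball.mem_nhds hmem)).comp_ofReal_real).congr heq

/-- The remainder estimate only reaches `y` with `|y - x| < min x y / √2`; the real-analytic
identity theorem carries the equality to the rest of the disc. -/
lemma taylorSum_eqOn {g : ℝ → ℂ} (hg : ContDiffOn ℝ ∞ g (Ioo 0 (1 / 2)))
    (hfin : armSum (fun n x => iteratedDeriv n g x) < ⊤) {x : ℝ} (hx : x ∈ Ioo (0 : ℝ) (1 / 2))
    (hconv : ConvergesOnDisk g x) :
    EqOn (fun t : ℝ => taylorSum g x t) g
      (Ioo 0 (1 / 2) ∩ Metric.ball x (x / Real.sqrt 2)) := by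
  have hx0 := hx.1
  refine AnalyticOnNhd.eqOn_of_preconnected_of_eventuallyEq (𝕜 := ℝ) (z₀ := x) ?_ ?_
    (((convex_Ioo _ _).inter (convex_ball _ _)).isPreconnected)
    ⟨hx, Metric.mem_ball_self (by positivity)⟩ ?_
  · intro t ht
    refine (hconv.differentiableOn.analyticAt (Metric.isOpen_ball.mem_nhds ?_)).comp_ofReal_real
    exact ofReal_mem_ball.2 (by simpa [Real.dist_eq] using ht.2)
  · exact fun t ht => analyticAt_of_armSum_lt_top hg hfin ht.1
  · have hxV : x ∈ Ioo (7 / 8 * x) (9 / 8 * x) := ⟨by linarith, by linarith⟩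
    filter_upwards [isOpen_Ioo.mem_nhds hxV, isOpen_Ioo.mem_nhds hx] with t ht ht'
    refine taylorSum_eq hg hfin hconv (α := 7 / 8 * x) (by positivity) hx ht' hxV.1.le ht.1.le ?_
    refine lt_of_lt_of_le ?_ (seven_eighths_bound hx0)
    rw [abs_lt]
    constructor <;> linarith [ht.1, ht.2]

/-- Feeds equality on a real segment into the complex identity theorem. The one-sided form is needed
at `1/2`, where an arm arrives only from the left. -/
lemma frequently_nhdsNE_of_eventually_ofReal {p : ℂ → Prop} {t : ℝ}
    (h : ∀ᶠ s : ℝ in 𝓝[<] t, p s) : ∃ᶠ z in 𝓝[≠] (t : ℂ), p z := by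
  have hlim : Tendsto (fun s : ℝ => (s : ℂ)) (𝓝[<] t) (𝓝[≠] (t : ℂ)) := by
    refine tendsto_nhdsWithin_iff.2 ⟨?_, ?_⟩
    · exact Complex.continuous_ofReal.continuousAt.mono_left nhdsWithin_le_nhds
    · filter_upwards [self_mem_nhdsWithin] with s hs
      simpa using (ne_of_lt hs)
  exact hlim.frequently h.frequently

/-! ### Holomorphic extension from one arm -/

/-- The union of the discs about the points of `(0, 1/2]`. -/
def armRegion : Set ℂ := ⋃ x ∈ Ioc (0 : ℝ) (1 / 2), Metric.ball (x : ℂ) (x / Real.sqrt 2)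

lemma mem_armRegion {z : ℂ} : z ∈ armRegion ↔
    ∃ x ∈ Ioc (0 : ℝ) (1 / 2), z ∈ Metric.ball (x : ℂ) (x / Real.sqrt 2) := by
  simp [armRegion]

lemma isOpen_armRegion : IsOpen armRegion :=
  isOpen_biUnion fun _ _ => Metric.isOpen_ball

lemma armRegion_subset_square : armRegion ⊆ square :=
  iUnion₂_subset fun _ hx => ball_subset_square hx

lemma taylorSum_compatible {g : ℝ → ℂ} (hg : ContDiffOn ℝ ∞ g (Ioo 0 (1 / 2)))
    (hfin : armSum (fun n x => iteratedDeriv n g x) < ⊤) {x y : ℝ} (hxy : x ≤ y)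
    (hx : x ∈ Ioo (0 : ℝ) (1 / 2)) (hy : y ∈ Ioo (0 : ℝ) (1 / 2)) (hcx : ConvergesOnDisk g x)
    (hcy : ConvergesOnDisk g y) : EqOn (taylorSum g x) (taylorSum g y)
      (Metric.ball (x : ℂ) (x / Real.sqrt 2) ∩ Metric.ball (y : ℂ) (y / Real.sqrt 2)) := by
  intro z hz
  have hy0 := hy.1
  have hre : ∀ s : ℝ, |z.re - s| ≤ ‖z - s‖ := fun s => by
    simpa using Complex.abs_re_le_norm (z - s)
  have hzx := mem_ball_iff_norm.1 hz.1
  have hzy := mem_ball_iff_norm.1 hz.2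
  have hz0 : 0 < z.re := by
    have h1 := ball_subset_square ⟨hx.1, hx.2.le⟩ hz.1
    rw [mem_square_iff] at h1
    have h2 := abs_lt.1 (lt_of_le_of_lt (le_add_of_nonneg_right (abs_nonneg _)) h1)
    norm_num at h2
    linarith
  -- A real point common to both discs and inside `(0, 1/2)`. `Re z` may exceed `1/2`, hence the cap
  -- at the larger centre `y`, which stays in the disc about `x` because `x ≤ y ≤ Re z` in that
  -- case.
  set t := min z.re y with ht
  have htI : t ∈ Ioo (0 : ℝ) (1 / 2) := ⟨lt_min hz0 hy0, (min_le_right _ _).trans_lt hy.2⟩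
  have htx : |t - x| < x / Real.sqrt 2 := by
    rcases le_total z.re y with h | h
    · rw [ht, min_eq_left h]
      exact (hre x).trans_lt hzx
    · rw [ht, min_eq_right h, abs_of_nonneg (by linarith)]
      linarith [le_abs_self (z.re - x), hre x]
  have hty : |t - y| < y / Real.sqrt 2 := by
    rcases le_total z.re y with h | h
    · rw [ht, min_eq_left h]
      exact (hre y).trans_lt hzy
    · rw [ht, min_eq_right h, sub_self, abs_zero]
      positivity
  refine AnalyticOnNhd.eqOn_of_preconnected_of_frequently_eq (z₀ := (t : ℂ))
    ((hcx.differentiableOn.analyticOnNhd Metric.isOpen_ball).mono inter_subset_left)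
    ((hcy.differentiableOn.analyticOnNhd Metric.isOpen_ball).mono inter_subset_right)
    ((convex_ball _ _).inter (convex_ball _ _)).isPreconnected
    ⟨ofReal_mem_ball.2 htx, ofReal_mem_ball.2 hty⟩ ?_ hz
  refine frequently_nhdsNE_of_eventually_ofReal (nhdsWithin_le_nhds ?_)
  have hx' : t ∈ Metric.ball x (x / Real.sqrt 2) := by rwa [Metric.mem_ball, Real.dist_eq]
  have hy' : t ∈ Metric.ball y (y / Real.sqrt 2) := by rwa [Metric.mem_ball, Real.dist_eq]
  filter_upwards [isOpen_Ioo.mem_nhds htI, Metric.isOpen_ball.mem_nhds hx',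
    Metric.isOpen_ball.mem_nhds hy'] with s hs hsx hsy
  exact (taylorSum_eqOn hg hfin hx hcx ⟨hs, hsx⟩).trans
    (taylorSum_eqOn hg hfin hy hcy ⟨hs, hsy⟩).symm

/-- A smooth function on `(0, 1/2)` with finite arm sum extends holomorphically to the arm
region. -/
theorem exists_holomorphic_extension {g : ℝ → ℂ} (hg : ContDiffOn ℝ ∞ g (Ioo 0 (1 / 2)))
    (hfin : armSum (fun n x => iteratedDeriv n g x) < ⊤) :
    ∃ G : ℂ → ℂ, DifferentiableOn ℂ G armRegion ∧ ∀ t ∈ Ioo (0 : ℝ) (1 / 2), G t = g t := by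
  let ι := {x : ℝ // x ∈ Ioo (0 : ℝ) (1 / 2) ∧ ConvergesOnDisk g x}
  let s : ι → Set ℂ := fun i => Metric.ball (i.1 : ℂ) (i.1 / Real.sqrt 2)
  obtain ⟨G, hG⟩ := exists_eqOn_of_compatible (s := s) (H := fun i : ι => taylorSum g i.1)
    (fun i j => by
      rcases le_total i.1 j.1 with h | h
      · exact taylorSum_compatible hg hfin h i.2.1 j.2.1 i.2.2 j.2.2
      · rw [inter_comm]
        exact (taylorSum_compatible hg hfin h j.2.1 i.2.1 j.2.2 i.2.2).symm)
  have hsub : armRegion ⊆ ⋃ i, s i := by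
    intro z hz
    obtain ⟨x, hx, hzx⟩ := mem_armRegion.1 hz
    -- The condition on the centre is open, so any centre, including the endpoint `1/2`, can be
    -- moved to a good one in `(0, 1/2)`.
    set V : Set ℝ := {y | ‖z - y‖ < y / Real.sqrt 2} with hV
    have hVo : IsOpen V := isOpen_lt (by fun_prop) (by fun_prop)
    have hxV : x ∈ V := mem_ball_iff_norm.1 hzx
    have hcl : x ∈ closure (Ioo (0 : ℝ) (1 / 2)) := by
      rw [closure_Ioo (by norm_num)]
      exact ⟨hx.1.le, hx.2⟩
    obtain ⟨y, hy, hcy⟩ := exists_convergesOnDisk hg hfin hVo (mem_closure_iff.1 hcl V hVo hxV)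
    exact mem_iUnion.2 ⟨⟨y, hy.2, hcy⟩, mem_ball_iff_norm.2 hy.1⟩
  refine ⟨G, (differentiableOn_iUnion_of_eqOn (fun _ => Metric.isOpen_ball)
    (fun i => i.2.2.differentiableOn) hG).mono hsub, fun t ht => ?_⟩
  have htA : (t : ℂ) ∈ armRegion := mem_armRegion.2 ⟨t, ⟨ht.1, ht.2.le⟩,
    Metric.mem_ball_self (div_pos ht.1 (by positivity))⟩
  obtain ⟨i, hi⟩ := mem_iUnion.1 (hsub htA)
  rw [hG i hi]
  refine taylorSum_eqOn hg hfin i.2.1 i.2.2 ⟨ht, ?_⟩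
  rw [Metric.mem_ball, Real.dist_eq]
  exact ofReal_mem_ball.1 hi

/-! ### Gluing the four arms across the inscribed disc -/

/-- The inscribed disc of the square. -/
def inscribedDisk : Set ℂ := Metric.ball (1 / 2 : ℂ) (1 / 2 / Real.sqrt 2)

lemma inscribedDisk_subset_armRegion : inscribedDisk ⊆ armRegion := fun z hz =>
  mem_armRegion.2 ⟨1 / 2, ⟨by norm_num, le_rfl⟩, by simpa [inscribedDisk] using hz⟩

lemma half_mem_inscribedDisk : (1 / 2 : ℂ) ∈ inscribedDisk :=
  Metric.mem_ball_self (by positivity)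

lemma mem_inscribedDisk_iff {z : ℂ} :
    z ∈ inscribedDisk ↔ (z.re - 1 / 2) ^ 2 + z.im ^ 2 < 1 / 8 := by
  rw [inscribedDisk, mem_ball_iff_norm, ← sq_lt_sq₀ (norm_nonneg _) (by positivity), div_pow,
    Real.sq_sqrt (by norm_num), ← Complex.normSq_eq_norm_sq, Complex.normSq_apply]
  norm_num
  ring_nf

lemma rot_mem_inscribedDisk_iff {u : ℂ} (hu : ‖u‖ = 1) (z : ℂ) :
    rot u z ∈ inscribedDisk ↔ z ∈ inscribedDisk := by
  rw [inscribedDisk, mem_ball_iff_norm, mem_ball_iff_norm, rot_sub_half, norm_mul, hu, one_mul]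

/-- With `a = Re z`, the quantity `x²/2 - (a - x)²` increases in `x` up to `2a`. For `a ≥ 1/4` this
covers all `x ≤ 1/2`, so the disc about `1/2` is the most generous. -/
lemma re_lt_or_mem_inscribedDisk {z : ℂ} (hz : z ∈ armRegion) :
    z.re < 1 / 4 ∨ z ∈ inscribedDisk := by
  obtain ⟨x, hx, hzx⟩ := mem_armRegion.1 hz
  refine or_iff_not_imp_left.2 fun h => mem_inscribedDisk_iff.2 ?_
  have hx0 := hx.1
  have hx2 := hx.2
  rw [mem_ball_iff_norm, ← sq_lt_sq₀ (norm_nonneg _) (by positivity), div_pow,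
    Real.sq_sqrt (by norm_num), ← Complex.normSq_eq_norm_sq, Complex.normSq_apply] at hzx
  simp only [Complex.sub_re, Complex.sub_im, Complex.ofReal_re, Complex.ofReal_im, sub_zero] at hzx
  nlinarith [mul_nonneg (sub_nonneg.2 hx2) (sub_nonneg.2 (not_lt.1 h))]

lemma leftQuarter_subset_armRegion : leftQuarter ⊆ armRegion := by
  rintro z ⟨h1, h2⟩
  simp only [square, mem_ofPred_eq] at h1 h2
  have hb := abs_nonneg z.im
  rw [abs_of_nonpos (by linarith)] at h1
  rcases le_or_gt z.re (1 / 4) with h | h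
  -- The centre `2 Re z` maximises `x²/2 - (Re z - x)²`; membership then reduces to `|Im z| < Re z`.
  · refine mem_armRegion.2 ⟨2 * z.re, ⟨by linarith, by linarith⟩, ?_⟩
    have h0 : 0 < 2 * z.re := by linarith
    rw [mem_ball_iff_norm, ← sq_lt_sq₀ (norm_nonneg _) (by positivity), div_pow,
      Real.sq_sqrt (by norm_num), ← Complex.normSq_eq_norm_sq, Complex.normSq_apply]
    simp only [Complex.sub_re, Complex.sub_im, Complex.ofReal_re, Complex.ofReal_im, sub_zero]
    nlinarith [sq_abs z.im]
  · refine inscribedDisk_subset_armRegion (mem_inscribedDisk_iff.2 ?_)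
    rw [← sq_abs z.im]
    nlinarith

/-- The arm region seen from the vertex `rot (turn j) 0`. -/
def turnedRegion (j : Fin 4) : Set ℂ := rot (turn j)⁻¹ ⁻¹' armRegion

lemma isOpen_turnedRegion (j : Fin 4) : IsOpen (turnedRegion j) :=
  isOpen_armRegion.preimage (differentiable_rot _).continuous

lemma norm_turn_inv (j : Fin 4) : ‖(turn j)⁻¹‖ = 1 := by
  rw [norm_inv, norm_turn, inv_one]

lemma inscribedDisk_subset_turnedRegion (j : Fin 4) : inscribedDisk ⊆ turnedRegion j := fun z hz =>
  inscribedDisk_subset_armRegion ((rot_mem_inscribedDisk_iff (norm_turn_inv j) z).2 hz)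

lemma iUnion_turnedRegion : ⋃ j, turnedRegion j = square := by
  refine Subset.antisymm (iUnion_subset fun j z hz => ?_) fun z hz => ?_
  · have := armRegion_subset_square hz
    rwa [← rot_turn_mem_square_iff j, rot_rot_inv (turn_ne_zero j)] at this
  · obtain ⟨j, hj⟩ := exists_rot_inv_mem_leftQuarter hz
    exact mem_iUnion.2 ⟨j, leftQuarter_subset_armRegion hj⟩

lemma re_rot_turn_inv (j : Fin 4) (z : ℂ) : (rot (turn j)⁻¹ z).re =
    1 / 2 + ![z.re - 1 / 2, -(z.re - 1 / 2), -z.im, z.im] j := by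
  fin_cases j
  · simp [rot, show turn 0 = 1 from rfl]
  · simp [rot, show turn 1 = -1 from rfl]
  · simp [rot, show turn 2 = -Complex.I from rfl]
  · simp [rot, show turn 3 = Complex.I from rfl]

/-- Outside the inscribed disc, a point of an arm is more than `1/4` from the centre along that
arm's direction. Two opposite directions exclude each other, and two perpendicular ones violate `|Re
z - 1/2| + |Im z| < 1/2`. -/
lemma turnedRegion_inter_subset {i j : Fin 4} (hij : i ≠ j) :
    turnedRegion i ∩ turnedRegion j ⊆ inscribedDisk := by
  rintro z ⟨hi, hj⟩
  have hz : z ∈ square := iUnion_turnedRegion ▸ mem_iUnion.2 ⟨i, hi⟩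
  rcases re_lt_or_mem_inscribedDisk hi with hi | hi
  · rcases re_lt_or_mem_inscribedDisk hj with hj | hj
    · exfalso
      simp only [square, mem_ofPred_eq] at hz
      rw [re_rot_turn_inv] at hi hj
      have h1 := le_abs_self (z.re - 1 / 2)
      have h2 := neg_le_abs (z.re - 1 / 2)
      have h3 := le_abs_self z.im
      have h4 := neg_le_abs z.im
      fin_cases i <;> fin_cases j <;> simp at hij hi hj <;> linarith
    · exact (rot_mem_inscribedDisk_iff (norm_turn_inv j) z).1 hj
  · exact (rot_mem_inscribedDisk_iff (norm_turn_inv i) z).1 hi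

lemma rot_half (u : ℂ) : rot u (1 / 2) = 1 / 2 := by simp [rot]

/-- Holomorphic functions on the turned regions with a common germ at the centre glue. -/
lemma exists_glue_turnedRegion {H : Fin 4 → ℂ → ℂ} {f : ℂ → ℂ}
    (hH : ∀ j, DifferentiableOn ℂ (H j) (turnedRegion j))
    (hf : ∀ j, H j =ᶠ[𝓝 (1 / 2 : ℂ)] f) :
    ∃ F : ℂ → ℂ, DifferentiableOn ℂ F square ∧ ∀ j, EqOn F (H j) (turnedRegion j) := by
  obtain ⟨F, hF⟩ := exists_eqOn_of_compatible (s := turnedRegion) (H := H) (fun i j => by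
    rcases eq_or_ne i j with rfl | hij
    · exact fun _ _ => rfl
    · have han : ∀ k, AnalyticOnNhd ℂ (H k) inscribedDisk := fun k =>
        ((hH k).mono (inscribedDisk_subset_turnedRegion k)).analyticOnNhd Metric.isOpen_ball
      exact ((han i).eqOn_of_preconnected_of_eventuallyEq (han j)
        (convex_ball _ _).isPreconnected half_mem_inscribedDisk
        ((hf i).trans (hf j).symm)).mono (turnedRegion_inter_subset hij))
  refine ⟨F, ?_, hF⟩
  rw [← iUnion_turnedRegion]
  exact differentiableOn_iUnion_of_eqOn isOpen_turnedRegion hH hF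

/-! ### Derivatives along the diagonals -/

lemma iteratedDeriv_comp_ofReal_eqOn {F : ℂ → ℂ} (hF : DifferentiableOn ℂ F square) (n : ℕ) :
    EqOn (iteratedDeriv n (fun t : ℝ => F t)) (fun t : ℝ => iteratedDeriv n F t)
      (Ioo 0 (1 / 2)) := by
  induction n with
  | zero => exact fun t _ => by simp
  | succ n ih =>
    intro t ht
    have ht' : (t : ℂ) ∈ square := ball_subset_square ⟨ht.1, ht.2.le⟩
      (Metric.mem_ball_self (div_pos ht.1 (by positivity)))
    have han : AnalyticAt ℂ (iteratedDeriv n F) t := by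
      rw [iteratedDeriv_eq_iterate]
      exact (hF.analyticAt (isOpen_square.mem_nhds ht')).iterated_deriv n
    rw [iteratedDeriv_succ, (ih.eventuallyEq_of_mem (isOpen_Ioo.mem_nhds ht)).deriv_eq]
    simp only [iteratedDeriv_succ]
    exact (han.differentiableAt.hasDerivAt.comp_ofReal).deriv

lemma rot_turn_one_ofReal (t : ℝ) : rot (turn 1) t = ((1 - t : ℝ) : ℂ) := by
  rw [show turn 1 = -1 from rfl, rot]
  push_cast
  ring

lemma rot_turn_zero (z : ℂ) : rot (turn 0) z = z := by
  rw [show turn 0 = 1 from rfl, rot]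
  ring

lemma rot_turn_two_ofReal (t : ℝ) :
    rot (turn 2) t = 1 / 2 + Complex.I * ((1 / 2 - t : ℝ) : ℂ) := by
  rw [show turn 2 = -Complex.I from rfl, rot]
  push_cast
  ring

lemma rot_turn_three_ofReal (t : ℝ) :
    rot (turn 3) t = 1 / 2 + Complex.I * ((t - 1 / 2 : ℝ) : ℂ) := by
  rw [show turn 3 = Complex.I from rfl, rot]
  push_cast
  ring

/-- Reversing a parameter or passing from `d/dt` to `d/dz` costs only a unimodular factor. On the
vertical arms `x < 1/2` gives `z.im ≠ 0`, hence the second branch of the definition. -/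
lemma norm_derivAlongDiagonals_rot_turn (f : ℂ → ℂ) (n : ℕ) (j : Fin 4) {x : ℝ}
    (hx : x ∈ Ioo (0 : ℝ) (1 / 2)) : ‖derivAlongDiagonals f n (rot (turn j) x)‖ =
      ‖iteratedDeriv n (fun t : ℝ => f (rot (turn j) t)) x‖ := by
  fin_cases j
  · simp [rot_turn_zero, derivAlongDiagonals]
  · simp only [Fin.mk_one, rot_turn_one_ofReal, derivAlongDiagonals, Complex.ofReal_im, if_true,
      Complex.ofReal_re]
    rw [iteratedDeriv_comp_const_sub n (fun s : ℝ => f s)]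
    simp
  · have h : (1 / 2 + Complex.I * ((1 / 2 - x : ℝ) : ℂ)).im = 1 / 2 - x := by simp
    simp only [Fin.reduceFinMk, rot_turn_two_ofReal, derivAlongDiagonals, h]
    rw [if_neg (by linarith [hx.2]),
      iteratedDeriv_comp_const_sub n (fun s : ℝ => f (1 / 2 + Complex.I * s))]
    simp
  · have h : (1 / 2 + Complex.I * ((x - 1 / 2 : ℝ) : ℂ)).im = x - 1 / 2 := by simp
    simp only [Fin.reduceFinMk, rot_turn_three_ofReal, derivAlongDiagonals, h]
    rw [if_neg (by linarith [hx.2]),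
      iteratedDeriv_comp_sub_const n (fun s : ℝ => f (1 / 2 + Complex.I * s))]
    simp

lemma SmoothOnDiagonals.contDiffOn_rot_turn {f : ℂ → ℂ} (hf : SmoothOnDiagonals f) (j : Fin 4) :
    ContDiffOn ℝ ∞ (fun t : ℝ => f (rot (turn j) t)) (Ioo 0 (1 / 2)) := by
  fin_cases j
  · simp only [Fin.zero_eta, rot_turn_zero]
    exact hf.1.mono (Ioo_subset_Ioo_right (by norm_num))
  · simp only [Fin.mk_one, rot_turn_one_ofReal]
    exact hf.1.comp (f := fun t : ℝ => 1 - t) (by fun_prop)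
      fun t ht => ⟨by linarith [ht.2], by linarith [ht.1]⟩
  · simp only [Fin.reduceFinMk, rot_turn_two_ofReal]
    exact hf.2.comp (f := fun t : ℝ => 1 / 2 - t) (by fun_prop)
      fun t ht => ⟨by linarith [ht.2], by linarith [ht.1]⟩
  · simp only [Fin.reduceFinMk, rot_turn_three_ofReal]
    exact hf.2.comp (f := fun t : ℝ => t - 1 / 2) (by fun_prop)
      fun t ht => ⟨by linarith [ht.1], by linarith [ht.2]⟩

lemma exists_rot_turn_eq {z : ℂ} (hz : z ∈ horizontalDiagonal ∪ verticalDiagonal) :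
    z = 1 / 2 ∨ ∃ j, ∃ t ∈ Ioo (0 : ℝ) (1 / 2), z = rot (turn j) t := by
  rcases hz with ⟨⟨h0, h1⟩, him⟩ | ⟨hre, h0, h1⟩
  · rcases lt_trichotomy z.re (1 / 2) with h | h | h
    · refine Or.inr ⟨0, z.re, ⟨h0, h⟩, ?_⟩
      rw [rot_turn_zero]
      exact Complex.ext rfl him
    · exact Or.inl (Complex.ext (by simp [h]) (by simp [him]))
    · refine Or.inr ⟨1, 1 - z.re, ⟨by linarith, by linarith⟩, ?_⟩
      rw [rot_turn_one_ofReal]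
      exact Complex.ext (by simp) (by simp [him])
  · rcases lt_trichotomy z.im 0 with h | h | h
    · refine Or.inr ⟨3, 1 / 2 + z.im, ⟨by linarith, by linarith⟩, ?_⟩
      rw [rot_turn_three_ofReal]
      exact Complex.ext (by simp [hre]) (by simp)
    · exact Or.inl (Complex.ext (by simp [hre]) (by simp [h]))
    · refine Or.inr ⟨2, 1 / 2 - z.im, ⟨by linarith, by linarith⟩, ?_⟩
      rw [rot_turn_two_ofReal]
      exact Complex.ext (by simp [hre]) (by simp)

lemma diagonalSum_congr {d d' : ℕ → ℂ → ℂ} (h : ∀ n j, ∀ x ∈ Ioo (0 : ℝ) (1 / 2),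
    ‖d n (rot (turn j) x)‖ = ‖d' n (rot (turn j) x)‖) : diagonalSum d = diagonalSum d' := by
  rw [diagonalSum_eq_sum_rot, diagonalSum_eq_sum_rot]
  refine tsum_congr fun n => ?_
  congr 1
  refine setLIntegral_congr_fun measurableSet_Ioo fun x hx => ?_
  simp only [h n _ x hx]

/-! ### Extension to the square and the theorem -/

/-- A function on the diagonals with finite diagonal sum extends holomorphically to the square. -/
theorem exists_holomorphic_extension_square {f : ℂ → ℂ} (hf : SmoothOnDiagonals f) {U : Set ℂ}
    (hU : IsOpen U) (hmem : (1 / 2 : ℂ) ∈ U) (hd : DifferentiableOn ℂ f U)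
    (hfin : diagonalSum (derivAlongDiagonals f) < ⊤) :
    ∃ F : ℂ → ℂ, DifferentiableOn ℂ F square ∧ F =ᶠ[𝓝 (1 / 2 : ℂ)] f ∧
      ∀ j, ∀ t ∈ Ioo (0 : ℝ) (1 / 2), F (rot (turn j) t) = f (rot (turn j) t) := by
  have harm : ∀ j, armSum (fun n x => iteratedDeriv n (fun t : ℝ => f (rot (turn j) t)) x) < ⊤ := by
    intro j
    refine lt_of_le_of_lt ?_ hfin
    rw [← armSum_congr fun n x hx => norm_derivAlongDiagonals_rot_turn f n j hx]
    exact armSum_le_diagonalSum _ j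
  choose G hG hGf using fun j => exists_holomorphic_extension (hf.contDiffOn_rot_turn j) (harm j)
  have hhalf : ((1 / 2 : ℝ) : ℂ) = 1 / 2 := by norm_num
  -- Both sides are analytic at `1/2` and agree at real points just left of it. This is where
  -- holomorphy of `f` near the centre ties the four extensions together.
  have hgerm : ∀ j, G j =ᶠ[𝓝 (1 / 2 : ℂ)] fun z => f (rot (turn j) z) := by
    intro j
    have h1 : AnalyticAt ℂ (G j) (1 / 2) := (hG j).analyticAt
      (isOpen_armRegion.mem_nhds (inscribedDisk_subset_armRegion half_mem_inscribedDisk))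
    have h2 : AnalyticAt ℂ (fun z => f (rot (turn j) z)) (1 / 2) := by
      have h3 : AnalyticAt ℂ f (rot (turn j) (1 / 2)) := by
        rw [rot_half]
        exact hd.analyticAt (hU.mem_nhds hmem)
      exact h3.fun_comp ((differentiable_rot _).analyticAt _)
    refine (h1.frequently_eq_iff_eventually_eq h2).1 ?_
    rw [← hhalf]
    refine frequently_nhdsNE_of_eventually_ofReal ?_
    filter_upwards [Ioo_mem_nhdsLT (show (0 : ℝ) < 1 / 2 by norm_num)] with t ht
    exact hGf j t ht
  let H : Fin 4 → ℂ → ℂ := fun j z => G j (rot (turn j)⁻¹ z)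
  have hHf : ∀ j, H j =ᶠ[𝓝 (1 / 2 : ℂ)] f := by
    intro j
    have hlim : Tendsto (rot (turn j)⁻¹) (𝓝 (1 / 2)) (𝓝 (1 / 2)) := by
      have := (differentiable_rot (turn j)⁻¹).continuous.tendsto (1 / 2)
      rwa [rot_half] at this
    filter_upwards [hlim.eventually (hgerm j)] with z hz
    change G j (rot (turn j)⁻¹ z) = f z
    rw [hz, rot_rot_inv (turn_ne_zero j)]
  obtain ⟨F, hF, hFH⟩ := exists_glue_turnedRegion (fun j => (hG j).comp
    (differentiable_rot _).differentiableOn fun z hz => hz) hHf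
  refine ⟨F, hF, ?_, fun j t ht => ?_⟩
  · exact ((hFH 0).eventuallyEq_of_mem ((isOpen_turnedRegion 0).mem_nhds
      (inscribedDisk_subset_turnedRegion 0 half_mem_inscribedDisk))).trans (hHf 0)
  · have htA : (t : ℂ) ∈ armRegion := mem_armRegion.2 ⟨t, ⟨ht.1, ht.2.le⟩,
      Metric.mem_ball_self (div_pos ht.1 (by positivity))⟩
    have hmem : rot (turn j) t ∈ turnedRegion j := by
      rw [turnedRegion, mem_preimage, rot_inv_rot (turn_ne_zero j)]
      exact htA
    rw [hFH j hmem]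
    change G j (rot (turn j)⁻¹ (rot (turn j) t)) = _
    rw [rot_inv_rot (turn_ne_zero j)]
    exact hGf j t ht

theorem mainTheorem1 :
    ∃ c C : ℝ≥0, 0 < c ∧ 0 < C ∧
      (∀ f : ℂ → ℂ, MemBergman f →
        (c : ℝ≥0∞) * bergmanNormSq f ≤ diagonalSum (fun n => iteratedDeriv n f) ∧
        diagonalSum (fun n => iteratedDeriv n f) ≤ (C : ℝ≥0∞) * bergmanNormSq f) ∧
      (∀ f : ℂ → ℂ, SmoothOnDiagonals f →
        (∃ U : Set ℂ, IsOpen U ∧ (1 / 2 : ℂ) ∈ U ∧ DifferentiableOn ℂ f U) →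
        diagonalSum (derivAlongDiagonals f) < ⊤ →
        ∃ F : ℂ → ℂ, MemBergman F ∧
          EqOn F f (horizontalDiagonal ∪ verticalDiagonal) ∧
          F =ᶠ[𝓝 (1 / 2 : ℂ)] f ∧
          (c : ℝ≥0∞) * bergmanNormSq F ≤ diagonalSum (derivAlongDiagonals f) ∧
          diagonalSum (derivAlongDiagonals f) ≤ (C : ℝ≥0∞) * bergmanNormSq F) := by
  have hc : ((1 / 4 : ℝ≥0) : ℝ≥0∞) = 1 / 4 := by
    rw [ENNReal.coe_div (by norm_num)]
    norm_num
  have hC : ((4 : ℝ≥0) : ℝ≥0∞) = 4 := by norm_num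
  refine ⟨1 / 4, 4, by norm_num, by norm_num, fun f hf => ?_, fun f hf ⟨U, hU, hmem, hd⟩ hfin => ?_⟩
  · rw [hc, hC]
    exact diagonalSum_bounds hf.1
  · rw [hc, hC]
    obtain ⟨F, hF, hgerm, hFf⟩ := exists_holomorphic_extension_square hf hU hmem hd hfin
    have hsum : diagonalSum (derivAlongDiagonals f) = diagonalSum (fun n => iteratedDeriv n F) := by
      refine diagonalSum_congr fun n j x hx => ?_
      have heq : EqOn (fun t : ℝ => f (rot (turn j) t)) (fun t : ℝ => F (rot (turn j) t))
        (Ioo 0 (1 / 2)) := fun t ht => (hFf j t ht).symm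
      rw [norm_derivAlongDiagonals_rot_turn f n j hx, heq.iteratedDeriv_of_isOpen isOpen_Ioo n hx,
        iteratedDeriv_comp_ofReal_eqOn (differentiableOn_comp_rot_turn hF j) n hx,
        norm_iteratedDeriv_comp_rot_turn]
    obtain ⟨hlow, hup⟩ := diagonalSum_bounds hF
    refine ⟨F, ⟨hF, ?_⟩, fun z hz => ?_, hgerm, hsum ▸ hlow, hsum ▸ hup⟩
    -- The lower bound holds for any holomorphic function, so the finite sum forces a finite norm.
    · rw [← hsum] at hlow
      have h := hlow.trans_lt hfin
      by_contra htop
      rw [not_lt, top_le_iff] at htop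
      rw [htop, ENNReal.mul_top (by simp)] at h
      exact lt_irrefl _ h
    · rcases exists_rot_turn_eq hz with rfl | ⟨j, t, ht, rfl⟩
      · exact hgerm.self_of_nhds
      · exact hFf j t ht
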